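/- Notation. Let $\mathbb H_{\mathbb C}$ be the algebra of complex $2\times2$ matrices $Z=(z_{ij})$, $N(Z)=\det Z$, $dV=\frac14\,dz_{11}\wedge dz_{12}\wedge dz_{21}\wedge dz_{22}$. For $R>0$ let $U(2)_R=\{RT:\ T\in U(2)\}$, oriented so that $\int_{U(2)_R}N(Z)^{-2}\,dV=-2\pi^3 i$, and let $\mathbb D^+_R=\{Z:\ ZZ^*<R^2\}$, $\mathbb D^-_R=\{Z:\ ZZ^*>R^2\}$. The group $GL(2,\mathbb H_{\mathbb C})\simeq GL(4,\mathbb C)$ consists of the invertible $2\times 2$ matrices with entries in $\mathbb H_{\mathbb C}$. Box diagrams. The one-loop box diagram has external vertices $Z_1,W_2,W_1,Z_2$ (in this cyclic order) and one solid vertex $T_1$, joined by solid edges to all four external vertices. An $n$-loop box diagram is obtained from an $(n-1)$-loop box diagram by attaching a slingshot at an external vertex $e\in\{Z_1,Z_2,W_1,W_2\}$: the vertex $e$ becomes a solid vertex $T_n$; a new external vertex labelled $e$ is added and joined to $T_n$ by a solid edge; $T_n$ is joined by solid edges to the two neighbours of $e$ in the cyclic order; and these two neighbours are joined to each other by a new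 dashed edge (dashed edges are counted with multiplicity). The variables carry the smallest transitive relation $\prec$ such that: in the one-loop diagram $W_1,W_2\prec T_1\prec Z_1,Z_2$; when a slingshot is attached at $e$, the old relations carry over with $e$ replaced by $T_n$, and for each of the three external vertices $v$ newly joined to $T_n$ one adds $T_n\prec v$ if $v\in\{Z_1,Z_2\}$ and $v\prec T_n$ if $v\in\{W_1,W_2\}$. Fix an $n$-loop box diagram ($n\ge1$) and real numbers $r_1,\dots,r_n>0$ with $r_i<r_j$ whenever $T_i\prec T_j$. Let $\Omega$ be the set of all $(Z_1,Z_2;W_1,W_2)$ with $Z_i\in\mathbb D^-_{r_{\max,i}}$, $W_i\in\mathbb D^+_{r_{\min,i}}$, $i=1,2$, where $r_{\max,i}=\max\{r_k:\ T_k\prec Z_i\}$ and $r_{\min,i}=\min\{r_k:\ W_i\prec T_k\}$. On $\Omega$ the $n$-loop box integral is $$ l^{(n)}(Z_1,Z_2;W_1,W_2)=\Bigl(\frac{i}{2\pi^3}\Bigr)^n\int_{T_1\in U(2)_{r_1}}\!\!\cdots\int_{T_n\in U(2)_{r_n}} \frac{\prod_{\text{dashed edges } Y Y'}N(Y-Y')}{\prod_{\text{solid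 edges } Y Y'}N(Y-Y')}\;dV_{T_1}\cdots dV_{T_n}. $$ Lemma. For $h=\begin{pmatrix}a'&b'\\c'&d'\end{pmatrix}\in GL(2,\mathbb H_{\mathbb C})$ write $h^{-1}=\begin{pmatrix}a&b\\c&d\end{pmatrix}$ and $\tilde Y=(aY+b)(cY+d)^{-1}$ whenever $cY+d$ is invertible. There is a neighbourhood of the identity in $GL(2,\mathbb H_{\mathbb C})$, depending only on the diagram and on $r_1,\dots,r_n$, such that for every $h$ in it $$ l^{(n)}(\tilde Z_1,\tilde Z_2;\tilde W_1,\tilde W_2)=N(a'-Z_1c')\,N(cZ_2+d)\,N(cW_1+d)\,N(a'-W_2c')\; l^{(n)}(Z_1,Z_2;W_1,W_2) $$ for all $(Z_1,Z_2;W_1,W_2)\in\Omega$ for which $\tilde Z_1,\tilde Z_2,\tilde W_1,\tilde W_2$ are defined and $(\tilde Z_1,\tilde Z_2;\tilde W_1,\tilde W_2)\in\Omega$. Moreover, for every compact $K\subset\Omega$, the latter condition holds for all points of $K$ as soon as $h$ is sufficiently close to the identity. -/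

import Mathlib

open scoped Matrix ComplexOrder Topology

/-- Complexified quaternions, realised as complex `2 × 2` matrices. -/
abbrev HC : Type := Matrix (Fin 2) (Fin 2) ℂ

/-- The group `GL(2, HC)` of invertible `2 × 2` matrices over the noncommutative ring `HC`. -/
abbrev GL2HC : Type := (Matrix (Fin 2) (Fin 2) HC)ˣ

namespace HC

/-- The quadratic form `N(Z) = det Z`. -/
noncomputable def N (Z : HC) : ℂ := Z.det

/-- The domain `𝔻⁺_R = {Z : Z Z^* < R ^ 2}`. -/
def DPlus (R : ℝ) : Set HC := {Z | (((R ^ 2 : ℝ) : ℂ) • (1 : HC) - Z * Zᴴ).PosDef}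

/-- The domain `𝔻⁻_R = {Z : Z Z^* > R ^ 2}`. -/
def DMinus (R : ℝ) : Set HC := {Z | (Z * Zᴴ - ((R ^ 2 : ℝ) : ℂ) • (1 : HC)).PosDef}

/-- The cycle `U(2)_R`, i.e. the set of all `R • T` with `T` unitary. -/
def U2 (R : ℝ) : Set HC := {Z | ∃ T : HC, T ∈ Matrix.unitaryGroup (Fin 2) ℂ ∧ Z = (R : ℂ) • T}

/-- The denominator `c Z + d` of the fractional linear transformation attached to `g`. -/
def denom (g : GL2HC) (Z : HC) : HC := g.val 1 0 * Z + g.val 1 1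

/-- The fractional linear transformation `Z ↦ (a Z + b) (c Z + d)⁻¹` attached to `g`. -/
noncomputable def moebius (g : GL2HC) (Z : HC) : HC :=
  (g.val 0 0 * Z + g.val 0 1) * (denom g Z)⁻¹

/-! ### Integration of `f dV` over the oriented cycle `U(2)_R`

The cycle is parametrised by the box below (injectively off a null set); the integral of the
holomorphic form `dV = (1/4) dz₁₁ ∧ dz₁₂ ∧ dz₂₁ ∧ dz₂₂` is the integral of its pull-back. -/

/-- The parametrisation of `U(2)_R`: the coordinates of `t` are the argument of `z₁₁`, the
angle `θ` with `|z₁₁| = R cos θ`, the argument of `z₁₂` and the argument of the determinant. -/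
noncomputable def u2Param (R : ℝ) (t : Fin 4 → ℝ) : HC :=
  !![R * Complex.exp (t 0 * Complex.I) * Complex.cos (t 1),
     R * Complex.exp (t 2 * Complex.I) * Complex.sin (t 1);
     -(R * Complex.exp ((t 3 - t 2) * Complex.I) * Complex.sin (t 1)),
     R * Complex.exp ((t 3 - t 0) * Complex.I) * Complex.cos (t 1)]

/-- The parameter box `[0, 2π] × [0, π/2] × [0, 2π] × [0, 2π]`. -/
noncomputable def u2Box : Set (Fin 4 → ℝ) :=
  Set.Icc 0 ![2 * Real.pi, Real.pi / 2, 2 * Real.pi, 2 * Real.pi]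

/-- The coordinates `z₁₁, z₁₂, z₂₁, z₂₂` on `HC`, in this order. -/
def coord (Z : HC) : Fin 4 → ℂ := ![Z 0 0, Z 0 1, Z 1 0, Z 1 1]

/-- The Jacobian matrix of the parametrisation: the entry `(i, j)` is the partial derivative of
the `i`-th coordinate on `HC` with respect to the `j`-th parameter. -/
noncomputable def u2Jacobian (R : ℝ) (t : Fin 4 → ℝ) : Matrix (Fin 4) (Fin 4) ℂ :=
  Matrix.of fun i j => deriv (fun s : ℝ => coord (u2Param R (Function.update t j s)) i) (t j)

/-- The density of the pull-back of `dV` to the parameter box. -/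
noncomputable def dVDensity (R : ℝ) (t : Fin 4 → ℝ) : ℂ := (1 / 4) * (u2Jacobian R t).det


theorem u2Jacobian_eq (R : ℝ) (t : Fin 4 → ℝ) :
    u2Jacobian R t = !![
      R * Complex.exp (t 0 * Complex.I) * Complex.cos (t 1) * Complex.I,
      -(R * Complex.exp (t 0 * Complex.I) * Complex.sin (t 1)), 0, 0;
      0, R * Complex.exp (t 2 * Complex.I) * Complex.cos (t 1),
      R * Complex.exp (t 2 * Complex.I) * Complex.sin (t 1) * Complex.I, 0;
      0, -(R * Complex.exp ((t 3 - t 2) * Complex.I) * Complex.cos (t 1)),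
      R * Complex.exp ((t 3 - t 2) * Complex.I) * Complex.sin (t 1) * Complex.I,
      -(R * Complex.exp ((t 3 - t 2) * Complex.I) * Complex.sin (t 1) * Complex.I);
      -(R * Complex.exp ((t 3 - t 0) * Complex.I) * Complex.cos (t 1) * Complex.I),
      -(R * Complex.exp ((t 3 - t 0) * Complex.I) * Complex.sin (t 1)), 0,
      R * Complex.exp ((t 3 - t 0) * Complex.I) * Complex.cos (t 1) * Complex.I] := by
  have h1 (a b c : ℂ) (x : ℝ) : deriv (fun s : ℝ => a * Complex.exp (((s : ℂ) - b) * Complex.I) * c) x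
      = a * Complex.exp ((x - b) * Complex.I) * c * Complex.I := by
    have := ((((((Complex.ofRealCLM.hasDerivAt (x := x)).sub_const b).mul_const
      Complex.I).cexp).const_mul a).mul_const c).deriv
    simpa [mul_assoc, mul_comm, mul_left_comm] using this
  have h2 (a b c : ℂ) (x : ℝ) : deriv (fun s : ℝ => a * Complex.exp ((b - (s : ℂ)) * Complex.I) * c) x
      = -(a * Complex.exp ((b - x) * Complex.I) * c * Complex.I) := by
    have := ((((((Complex.ofRealCLM.hasDerivAt (x := x)).const_sub b).mul_const
      Complex.I).cexp).const_mul a).mul_const c).deriv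
    simpa [mul_assoc, mul_comm, mul_left_comm] using this
  have h1' (a c : ℂ) (x : ℝ) : deriv (fun s : ℝ => a * Complex.exp ((s : ℂ) * Complex.I) * c) x
      = a * Complex.exp (x * Complex.I) * c * Complex.I := by
    simpa using h1 a 0 c x
  have h3 (a : ℂ) (x : ℝ) : deriv (fun s : ℝ => a * Complex.sin s) x = a * Complex.cos x := by
    exact (((Complex.hasDerivAt_sin (x : ℂ)).comp_ofReal).const_mul a).deriv
  have h4 (a : ℂ) (x : ℝ) : deriv (fun s : ℝ => a * Complex.cos s) x = -(a * Complex.sin x) := by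
    have := (((Complex.hasDerivAt_cos (x : ℂ)).comp_ofReal).const_mul a).deriv
    rwa [mul_neg] at this
  ext i j
  fin_cases i <;> fin_cases j <;>
    simp [u2Jacobian, coord, u2Param, Function.update, h1, h1', h2, h3, h4, -deriv_mul_const_field',
      -deriv_const_mul_field']

/-- Closed form of the density. -/
theorem dVDensity_eq (R : ℝ) (t : Fin 4 → ℝ) :
    dVDensity R t = -(Complex.I / 2) * R ^ 4 * Complex.exp (2 * t 3 * Complex.I) *
      Complex.sin (t 1) * Complex.cos (t 1) := by
  have e0 : Complex.exp ((t 3 - t 0) * Complex.I)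
      = Complex.exp (t 3 * Complex.I) * (Complex.exp (t 0 * Complex.I))⁻¹ := by
    rw [← Complex.exp_neg, ← Complex.exp_add]; ring_nf
  have e2 : Complex.exp ((t 3 - t 2) * Complex.I)
      = Complex.exp (t 3 * Complex.I) * (Complex.exp (t 2 * Complex.I))⁻¹ := by
    rw [← Complex.exp_neg, ← Complex.exp_add]; ring_nf
  have e3 : Complex.exp (2 * t 3 * Complex.I) = Complex.exp (t 3 * Complex.I) ^ 2 := by
    rw [← Complex.exp_nat_mul]; push_cast; ring_nf
  have hI : Complex.I ^ 2 = -1 := Complex.I_sq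
  have n0 := Complex.exp_ne_zero (t 0 * Complex.I)
  have n2 := Complex.exp_ne_zero (t 2 * Complex.I)
  rw [dVDensity, u2Jacobian_eq, e0, e2, e3]
  simp [Matrix.det_succ_row_zero, Fin.sum_univ_succ, Fin.succAbove]
  field_simp
  rw [hI]
  linear_combination (-4 * (R : ℂ) ^ 4 * Complex.cos (t 1) * Complex.sin (t 1)) *
    Complex.sin_sq_add_cos_sq (t 1 : ℂ)

/-- The determinant on the cycle. -/
theorem N_u2Param (R : ℝ) (t : Fin 4 → ℝ) :
    N (u2Param R t) = R ^ 2 * Complex.exp (t 3 * Complex.I) := by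
  have a : Complex.exp (t 0 * Complex.I) * Complex.exp ((t 3 - t 0) * Complex.I)
      = Complex.exp (t 3 * Complex.I) := by rw [← Complex.exp_add]; ring_nf
  have b : Complex.exp (t 2 * Complex.I) * Complex.exp ((t 3 - t 2) * Complex.I)
      = Complex.exp (t 3 * Complex.I) := by rw [← Complex.exp_add]; ring_nf
  simp only [N, u2Param, Matrix.det_fin_two_of]
  linear_combination (R : ℂ) ^ 2 * Complex.cos (t 1) ^ 2 * a + R ^ 2 * Complex.sin (t 1) ^ 2 * b
    + R ^ 2 * Complex.exp (t 3 * Complex.I) * Complex.sin_sq_add_cos_sq (t 1 : ℂ)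

/-- The orientation of `U(2)_R` is the one for which the integral of `dV / N ^ 2` is `-2π³i`. -/
theorem integral_dV_div_N_sq (R : ℝ) (hR : 0 < R) :
    (∫ t in u2Box, (N (u2Param R t) ^ 2)⁻¹ * dVDensity R t) =
      -2 * (Real.pi : ℂ) ^ 3 * Complex.I := by
  have hR' : (R : ℂ) ≠ 0 := by exact_mod_cast hR.ne'
  have h : ∀ t : Fin 4 → ℝ, (N (u2Param R t) ^ 2)⁻¹ * dVDensity R t =
      ∏ j, (![fun _ => -(Complex.I / 2), fun s => ((Real.sin s * Real.cos s : ℝ) : ℂ),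
        fun _ => 1, fun _ => 1] : Fin 4 → ℝ → ℂ) j (t j) := by
    intro t
    have e3 : Complex.exp (2 * t 3 * Complex.I) = Complex.exp (t 3 * Complex.I) ^ 2 := by
      rw [← Complex.exp_nat_mul]; push_cast; ring_nf
    have n0 := Complex.exp_ne_zero (t 3 * Complex.I)
    rw [N_u2Param, dVDensity_eq, e3]
    simp [Fin.prod_univ_four]
    field_simp
  simp_rw [h]
  have hb : u2Box = Set.univ.pi (fun j => Set.Icc (0 : ℝ)
      (![2 * Real.pi, Real.pi / 2, 2 * Real.pi, 2 * Real.pi] j)) := by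
    rw [u2Box, ← Set.pi_univ_Icc]; rfl
  rw [hb, MeasureTheory.volume_pi, MeasureTheory.Measure.restrict_pi_pi,
    MeasureTheory.integral_fintype_prod_eq_prod]
  have hs : ∫ s in Set.Icc (0 : ℝ) (Real.pi / 2), ((Real.sin s * Real.cos s : ℝ) : ℂ) = 1 / 2 := by
    rw [integral_complex_ofReal, MeasureTheory.integral_Icc_eq_integral_Ioc,
      ← intervalIntegral.integral_of_le (by positivity), integral_sin_mul_cos₁]
    simp
  have hp := Real.pi_pos
  have hv : MeasureTheory.volume.real (Set.Icc (0 : ℝ) (2 * Real.pi)) = 2 * Real.pi := by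
    rw [Real.volume_real_Icc_of_le (by positivity)]; ring
  have hcst : ∀ c : ℂ, ∫ _ in Set.Icc (0 : ℝ) (2 * Real.pi), c = 2 * Real.pi * c := by
    intro c
    rw [MeasureTheory.setIntegral_const, hv]; simp
  simp only [Fin.prod_univ_four, Matrix.cons_val]
  rw [hs, hcst, hcst]
  ring

/-- The parametrisation maps the box onto `U(2)_R`. -/
theorem u2Param_image (R : ℝ) : u2Param R '' u2Box = U2 R := by
  have hc : ∀ x : ℂ, (starRingEnd ℂ) (Complex.exp (x * Complex.I)) =
      Complex.exp (-((starRingEnd ℂ) x * Complex.I)) := by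
    intro x; rw [← Complex.exp_conj]; simp
  ext Z
  constructor
  · rintro ⟨t, -, rfl⟩
    refine ⟨u2Param 1 t, ?_, ?_⟩
    · have m : ∀ x : ℂ, Complex.exp (x * Complex.I) * Complex.exp (-(x * Complex.I)) = 1 := by
        intro x; rw [← Complex.exp_add]; simp
      have a : Complex.exp ((t 3 - t 0) * Complex.I)
          = Complex.exp (t 3 * Complex.I) * Complex.exp (-(t 0 * Complex.I)) := by
        rw [← Complex.exp_add]; ring_nf
      have b : Complex.exp ((t 3 - t 2) * Complex.I)
          = Complex.exp (t 3 * Complex.I) * Complex.exp (-(t 2 * Complex.I)) := by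
        rw [← Complex.exp_add]; ring_nf
      have cj : ∀ x : ℝ, (starRingEnd ℂ) (Complex.exp (x * Complex.I)) =
          Complex.exp (-(x * Complex.I)) := by
        intro x; rw [hc, Complex.conj_ofReal]
      have cj' : ∀ x : ℝ, (starRingEnd ℂ) (Complex.exp (-(x * Complex.I))) =
          Complex.exp (x * Complex.I) := by
        intro x; rw [← cj, Complex.conj_conj]
      have c0 := cj (t 0)
      have c2 := cj (t 2)
      have c3 := cj (t 3)
      have d0 := cj' (t 0)
      have d2 := cj' (t 2)
      have m0 := m (t 0)
      have m2 := m (t 2)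
      have m3 := m (t 3)
      have hsc := Complex.sin_sq_add_cos_sq (t 1 : ℂ)
      have hs : (starRingEnd ℂ) (Complex.sin (t 1)) = Complex.sin (t 1) := by
        rw [← Complex.sin_conj, Complex.conj_ofReal]
      have hco : (starRingEnd ℂ) (Complex.cos (t 1)) = Complex.cos (t 1) := by
        rw [← Complex.cos_conj, Complex.conj_ofReal]
      rw [Matrix.mem_unitaryGroup_iff, Matrix.star_eq_conjTranspose]
      generalize hA : Complex.exp (t 0 * Complex.I) = A at *
      generalize hA' : Complex.exp (-(t 0 * Complex.I)) = A' at *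
      generalize hB : Complex.exp (t 2 * Complex.I) = B at *
      generalize hB' : Complex.exp (-(t 2 * Complex.I)) = B' at *
      generalize hC : Complex.exp (t 3 * Complex.I) = C at *
      generalize hC' : Complex.exp (-(t 3 * Complex.I)) = C' at *
      generalize hS : Complex.sin (t 1) = S at *
      generalize hD : Complex.cos (t 1) = D at *
      ext i j
      fin_cases i <;> fin_cases j <;>
        simp [u2Param, Matrix.mul_apply, Fin.sum_univ_two, hs, hco, hA, hB, hS, hD,
          -Complex.ofReal_sin, -Complex.ofReal_cos, a, b, c0, c2, c3, d0, d2]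
      · linear_combination D ^ 2 * m0 + S ^ 2 * m2 + hsc
      · ring
      · ring
      · linear_combination S ^ 2 * B * B' * m3 + D ^ 2 * A * A' * m3 + D ^ 2 * m0 + S ^ 2 * m2 + hsc
    · ext i j
      fin_cases i <;> fin_cases j <;> simp [u2Param, mul_assoc]
  · rintro ⟨T, hT, rfl⟩
    have hpol : ∀ z : ℂ, ∃ φ : ℝ, 0 ≤ φ ∧ φ ≤ 2 * Real.pi ∧
        z = ‖z‖ * Complex.exp (φ * Complex.I) := by
      intro z
      have hp := Real.pi_pos
      rcases le_or_gt 0 z.arg with h | h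
      · exact ⟨z.arg, h, by linarith [Complex.arg_le_pi z], (Complex.norm_mul_exp_arg_mul_I z).symm⟩
      · refine ⟨z.arg + 2 * Real.pi, by linarith [Complex.neg_pi_lt_arg z], by linarith, ?_⟩
        push_cast
        rw [add_mul, Complex.exp_add, Complex.exp_two_pi_mul_I, mul_one,
          Complex.norm_mul_exp_arg_mul_I]
    have h1 := Matrix.mem_unitaryGroup_iff.1 hT
    have h2 := Matrix.mem_unitaryGroup_iff'.1 hT
    have hdet : T.det ∈ unitary ℂ := Matrix.det_of_mem_unitary hT
    have hnd : ‖T.det‖ = 1 := by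
      have h := (Unitary.mem_iff.1 hdet).1
      have h' := congrArg norm h
      rw [norm_mul, norm_star, norm_one] at h'
      nlinarith [norm_nonneg T.det]
    have hadj : T.adjugate = T.det • star T := by
      calc T.adjugate = T.adjugate * (T * star T) := by rw [h1, mul_one]
        _ = T.det • star T := by rw [← mul_assoc, Matrix.adjugate_mul, smul_mul_assoc, one_mul]
    rw [Matrix.adjugate_fin_two] at hadj
    have e22 : T 1 1 = T.det * (starRingEnd ℂ) (T 0 0) := by
      have := congrFun (congrFun hadj 0) 0
      simpa [Matrix.star_apply] using this
    have e21 : T 1 0 = -(T.det * (starRingEnd ℂ) (T 0 1)) := by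
      have := congrFun (congrFun hadj 1) 0
      simp [Matrix.star_apply] at this
      linear_combination -this
    have hrow : ‖T 0 0‖ ^ 2 + ‖T 0 1‖ ^ 2 = 1 := by
      have h := congrFun (congrFun h1 0) 0
      simp only [Matrix.mul_apply, Fin.sum_univ_two, Matrix.star_apply, Matrix.one_apply_eq,
        RCLike.star_def, Complex.mul_conj, Complex.normSq_eq_norm_sq] at h
      exact_mod_cast h
    obtain ⟨α, α0, α1, hα⟩ := hpol (T 0 0)
    obtain ⟨β, β0, β1, hβ⟩ := hpol (T 0 1)
    obtain ⟨γ, γ0, γ1, hγ⟩ := hpol T.det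
    have n0 := norm_nonneg (T 0 0)
    have n1 := norm_nonneg (T 0 1)
    have hle : ‖T 0 0‖ ≤ 1 := by nlinarith
    have hcos : Real.cos (Real.arccos ‖T 0 0‖) = ‖T 0 0‖ := Real.cos_arccos (by linarith) hle
    have hsin : Real.sin (Real.arccos ‖T 0 0‖) = ‖T 0 1‖ := by
      rw [Real.sin_arccos, ← hrow, add_sub_cancel_left, Real.sqrt_sq n1]
    rw [hnd, Complex.ofReal_one, one_mul] at hγ
    refine ⟨![α, Real.arccos ‖T 0 0‖, β, γ], ?_, ?_⟩
    · rw [u2Box, Set.mem_Icc, Pi.le_def, Pi.le_def]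
      constructor
      · intro i
        fin_cases i
        exacts [α0, Real.arccos_nonneg _, β0, γ0]
      · intro i
        fin_cases i
        exacts [α1, Real.arccos_le_pi_div_two.2 n0, β1, γ1]
    · have ca : (starRingEnd ℂ) (T 0 0) = ‖T 0 0‖ * Complex.exp (-(α * Complex.I)) := by
        conv_lhs => rw [hα]
        simp [hc]
      have cb : (starRingEnd ℂ) (T 0 1) = ‖T 0 1‖ * Complex.exp (-(β * Complex.I)) := by
        conv_lhs => rw [hβ]
        simp [hc]
      have hcos' : Complex.cos (Real.arccos ‖T 0 0‖ : ℝ) = ‖T 0 0‖ := by exact_mod_cast hcos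
      have hsin' : Complex.sin (Real.arccos ‖T 0 0‖ : ℝ) = ‖T 0 1‖ := by exact_mod_cast hsin
      rw [ca, hγ] at e22
      rw [cb, hγ] at e21
      ext i j
      fin_cases i <;> fin_cases j
      · simp only [u2Param]
        simp [-Complex.ofReal_cos, -Complex.ofReal_sin, hcos']
        linear_combination -(R : ℂ) * hα
      · simp only [u2Param]
        simp [-Complex.ofReal_cos, -Complex.ofReal_sin, hsin']
        linear_combination -(R : ℂ) * hβ
      · simp only [u2Param]
        simp [-Complex.ofReal_cos, -Complex.ofReal_sin, hsin', e21, sub_mul, Complex.exp_sub,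
          Complex.exp_neg]
        ring
      · simp only [u2Param]
        simp [-Complex.ofReal_cos, -Complex.ofReal_sin, hcos', e22, sub_mul, Complex.exp_sub,
          Complex.exp_neg]
        ring

/-- The integral `∫ F(T₁, …, Tₙ) dV_{T₁} ⋯ dV_{Tₙ}` over `U(2)_{r₁} × ⋯ × U(2)_{rₙ}`. -/
noncomputable def cycleIntegral {n : ℕ} (r : Fin n → ℝ) (F : (Fin n → HC) → ℂ) : ℂ :=
  ∫ t in Set.univ.pi (fun _ : Fin n => u2Box),
    F (fun k => u2Param (r k) (t k)) * ∏ k, dVDensity (r k) (t k)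

end HC

/-! ### Box diagrams -/

/-- The four external vertices of a box diagram, in the cyclic order `Z₁, W₂, W₁, Z₂`. -/
inductive External : Type
  | Z₁
  | Z₂
  | W₁
  | W₂
  deriving DecidableEq

/-- The two neighbours of an external vertex in the cyclic order `Z₁, W₂, W₁, Z₂`. -/
def External.nbrs : External → External × External
  | .Z₁ => (.Z₂, .W₂)
  | .Z₂ => (.Z₁, .W₁)
  | .W₁ => (.Z₂, .W₂)
  | .W₂ => (.Z₁, .W₁)

/-- Vertices of an `n`-loop diagram: the external ones and the solid vertices `T₁, …, Tₙ`. -/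
inductive Vertex (n : ℕ) : Type
  | ext (e : External)
  | T (k : Fin n)

/-- The solid edge joining `T_k` and an external vertex, written as `(lower, upper)` for the
order in which the `Zᵢ` are above and the `Wᵢ` are below the solid vertices. -/
def Vertex.leg {n : ℕ} (k : Fin n) : External → Vertex n × Vertex n
  | .Z₁ => (.T k, .ext .Z₁)
  | .Z₂ => (.T k, .ext .Z₂)
  | .W₁ => (.ext .W₁, .T k)
  | .W₂ => (.ext .W₂, .T k)

/-- An `n`-loop box diagram: the one-loop diagram with `n - 1` slingshots attached, where
`sling e d` attaches the hollow vertex of a slingshot to the external vertex `e` of `d`. -/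
inductive BoxDiagram : ℕ → Type
  | oneLoop : BoxDiagram 1
  | sling {n : ℕ} (e : External) (d : BoxDiagram n) : BoxDiagram (n + 1)

/-- Relabelling of the vertices of `d` when a slingshot is attached to `e`:
`e` becomes the new solid vertex, all other vertices keep their names. -/
def Vertex.relabel {n : ℕ} (e : External) : Vertex n → Vertex (n + 1)
  | .ext e' => if e' = e then .T (Fin.last n) else .ext e'
  | .T k => .T k.castSucc

namespace BoxDiagram

/-- The solid edges of a box diagram, each written as `(lower, upper)`. A slingshot attached
to `e` adds the handle, from the new solid vertex to the new external vertex `e`, and one solid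
edge from the new solid vertex to each of the two neighbours of `e`. -/
def solid : {n : ℕ} → BoxDiagram n → List (Vertex n × Vertex n)
  | _, oneLoop => [Vertex.leg 0 .Z₁, Vertex.leg 0 .Z₂, Vertex.leg 0 .W₁, Vertex.leg 0 .W₂]
  | _, sling (n := n) e d =>
      Vertex.leg (Fin.last n) e :: Vertex.leg (Fin.last n) e.nbrs.1 :: Vertex.leg (Fin.last n) e.nbrs.2 ::
        d.solid.map (Prod.map (Vertex.relabel e) (Vertex.relabel e))

/-- The dashed edges of a box diagram, with multiplicity. A slingshot attached to `e` adds one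
dashed edge (its string) between the two neighbours of `e`. -/
def dashed : {n : ℕ} → BoxDiagram n → List (Vertex n × Vertex n)
  | _, oneLoop => []
  | _, sling e d =>
      (.ext e.nbrs.1, .ext e.nbrs.2) ::
        d.dashed.map (Prod.map (Vertex.relabel e) (Vertex.relabel e))

/-- The ordering `≺` on the variables: the transitive relation generated by the solid edges. -/
def Prec {n : ℕ} (d : BoxDiagram n) : Vertex n → Vertex n → Prop :=
  Relation.TransGen fun u v => (u, v) ∈ d.solid

/-- Admissible radii for the cycles of integration. -/
def Admissible {n : ℕ} (d : BoxDiagram n) (r : Fin n → ℝ) : Prop :=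
  (∀ k, 0 < r k) ∧ ∀ i j, d.Prec (.T i) (.T j) → r i < r j

/-- The points `X = (Z₁, Z₂; W₁, W₂)` at which the integral with radii `r` is considered. As the
domains `𝔻⁻_R` decrease and the `𝔻⁺_R` increase with `R`, this says `Zᵢ ∈ 𝔻⁻_R` for
the largest `R = r_k` with `T_k ≺ Zᵢ`, and `Wᵢ ∈ 𝔻⁺_R` for the smallest `R = r_k` with
`Wᵢ ≺ T_k`. -/
def domain {n : ℕ} (d : BoxDiagram n) (r : Fin n → ℝ) : Set (External → HC) :=
  {X | ∀ k,
    (d.Prec (.T k) (.ext .Z₁) → X .Z₁ ∈ HC.DMinus (r k)) ∧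
    (d.Prec (.T k) (.ext .Z₂) → X .Z₂ ∈ HC.DMinus (r k)) ∧
    (d.Prec (.ext .W₁) (.T k) → X .W₁ ∈ HC.DPlus (r k)) ∧
    (d.Prec (.ext .W₂) (.T k) → X .W₂ ∈ HC.DPlus (r k))}

/-- The value of the variable attached to a vertex. -/
def value {n : ℕ} (X : External → HC) (T : Fin n → HC) : Vertex n → HC
  | .ext e => X e
  | .T k => T k

/-- The rational function of a box diagram: a factor `N(Y - Y')⁻¹` for each solid edge and
a factor `N(Y - Y')` for each dashed edge. -/
noncomputable def integrand {n : ℕ} (d : BoxDiagram n) (X : External → HC) (T : Fin n → HC) : ℂ :=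
  (d.dashed.map fun p => HC.N (value X T p.1 - value X T p.2)).prod *
    (d.solid.map fun p => (HC.N (value X T p.1 - value X T p.2))⁻¹).prod

/-- The conformal four-point integral `l⁽ⁿ⁾(Z₁, Z₂; W₁, W₂)` of a box diagram, where
`X = (Z₁, Z₂; W₁, W₂)` and `T_k` is integrated over `U(2)_{r_k}`. -/
noncomputable def l {n : ℕ} (d : BoxDiagram n) (r : Fin n → ℝ) (X : External → HC) : ℂ :=
  (Complex.I / (2 * (Real.pi : ℂ) ^ 3)) ^ n * HC.cycleIntegral r (d.integrand X)

end BoxDiagram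

/-!
The integrand is best viewed in homogeneous coordinates: `Y ∈ HC` is represented by the `4 × 2`
matrix `(Y, 1)`, fractional linear transformations become left multiplication by `4 × 4` matrices,
and `N(Y - Y')` becomes the `4 × 4` determinant `HV.bracket`. A diagram has `2 n + 2` more solid
than dashed edges, with an excess of `1` at each external vertex and of `4` at each solid vertex
(`BoxDiagram.edgeProd_scale`). Hence moving all the points by a matrix changes the integrand only by
a power of the determinant, and the weight `4` at a solid vertex is exactly the weight of `dV`.

Instead of moving the cycles by a fractional linear transformation, one differentiates. If the
external points move by an infinitesimal `ξ`, the integrand changes by `-2 tr ξ` times itself and by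
the divergences of the integrand times the induced holomorphic vector fields at the solid vertices
(`BoxDiagram.fderiv_kernel_external`). The latter integrate to zero because `U(2)_R` is a closed
cycle (`HC.integral_fderiv_single`, an instance of Stokes' theorem proved by the divergence theorem
on the parameter box). Integrating the resulting differential equation along the segment from `1` to
`A` gives `l(A u) = det(A)⁻² l(u)` as long as no pole meets the cycle along the segment
(`BoxDiagram.homIntegral_mul`).

This does not yet give a neighbourhood of the identity which is uniform in the external points,
since these may be arbitrarily close to the cycle. However, near `Zᵢ = ∞`, `Wᵢ = 0` the poles stay
away from the cycle for all `A` in a fixed neighbourhood of `1`. The path `(Z / s, s W)`,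
`0 < s ≤ 1`, joins that configuration to any given one. In terms of the hermitian form
`|P|² - R² |Q|²` the domains consist of planes on which the form is definite, and along the path the
form is concave or convex in `s`; so both the path and its image under `A` stay in the domain when
their end points do (`BoxDiagram.Tame.path_mem_good`). The identity then holds along the whole path
by analytic continuation (`BoxDiagram.homIntegral_mul_aff`). Working in homogeneous coordinates
also removes the poles of the transformation itself along the path. The last assertion of the
theorem holds because the domain is open.
-/

section

attribute [local instance] Matrix.normedAddCommGroup Matrix.normedSpace

/-! ### Stokes' theorem on `U(2)_R` -/

namespace HC

/-- The character `t ↦ exp (i ∑ aⱼ tⱼ)`, which is `2π`-periodic in every variable. -/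
noncomputable def boxChar (a : Fin 4 → ℤ) (t : Fin 4 → ℝ) : ℂ :=
  ∏ j, Complex.exp (t j * Complex.I) ^ a j

theorem boxChar_eq_exp (a : Fin 4 → ℤ) (t : Fin 4 → ℝ) :
    boxChar a t = Complex.exp (∑ j, ((t j : ℝ) : ℂ) * (a j * Complex.I)) := by
  rw [boxChar, Complex.exp_sum]
  refine Finset.prod_congr rfl fun j _ => ?_
  rw [← Complex.exp_int_mul]
  ring_nf

theorem hasFDerivAt_boxChar (a : Fin 4 → ℤ) (t : Fin 4 → ℝ) :
    HasFDerivAt (boxChar a) (boxChar a t • ∑ j,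
      (Complex.ofRealCLM.comp (ContinuousLinearMap.proj (R := ℝ) (φ := fun _ : Fin 4 => ℝ) j)).smulRight
        (a j * Complex.I)) t := by
  have h : boxChar a = fun t => Complex.exp (∑ j, ((t j : ℝ) : ℂ) * (a j * Complex.I)) :=
    funext (boxChar_eq_exp a)
  rw [boxChar_eq_exp, h]
  refine HasFDerivAt.cexp (HasFDerivAt.fun_sum fun j _ => ?_)
  exact ((Complex.ofRealCLM.comp
    (ContinuousLinearMap.proj (R := ℝ) (φ := fun _ : Fin 4 => ℝ) j)).smulRight
    ((a j : ℂ) * Complex.I)).hasFDerivAt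

theorem contDiff_u2Param (R : ℝ) : ContDiff ℝ 1 (u2Param R) := by
  refine contDiff_pi.2 fun i => contDiff_pi.2 fun j => ?_
  have h (k : Fin 4) : ContDiff ℝ 1 (fun t : Fin 4 → ℝ => ((t k : ℝ) : ℂ)) :=
    Complex.ofRealCLM.contDiff.comp (contDiff_apply ℝ ℝ k)
  have hs : ContDiff ℝ 1 Complex.sin := Complex.contDiff_sin.restrict_scalars ℝ
  have hc : ContDiff ℝ 1 Complex.cos := Complex.contDiff_cos.restrict_scalars ℝ
  have h0 := h 0
  have h1s := hs.comp (h 1)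
  have h1c := hc.comp (h 1)
  have h2 := h 2
  have h3 := h 3
  simp only [Function.comp_def] at h1s h1c
  fin_cases i <;> fin_cases j <;> simp [u2Param, -Complex.ofReal_sin, -Complex.ofReal_cos] <;>
    fun_prop

theorem fderiv_u2Param_single (R : ℝ) (t : Fin 4 → ℝ) (i j : Fin 4) :
    coord (fderiv ℝ (u2Param R) t (Pi.single j 1)) i = u2Jacobian R t i j := by
  have h1 := (((contDiff_u2Param R).differentiable one_ne_zero) t).hasFDerivAt
  have h2 : HasDerivAt (fun s : ℝ => u2Param R (Function.update t j s))
      (fderiv ℝ (u2Param R) t (Pi.single j 1)) (t j) := by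
    have h3 := hasDerivAt_update t j (t j)
    exact HasFDerivAt.comp_hasDerivAt (l := u2Param R) (t j)
      (by rwa [Function.update_eq_self]) h3
  have h4 : ∀ a b, HasDerivAt (fun s : ℝ => u2Param R (Function.update t j s) a b)
      (fderiv ℝ (u2Param R) t (Pi.single j 1) a b) (t j) := fun a b =>
    hasDerivAt_pi.1 (hasDerivAt_pi.1 h2 a) b
  simp only [u2Jacobian, Matrix.of_apply]
  symm
  fin_cases i
  exacts [(h4 0 0).deriv, (h4 0 1).deriv, (h4 1 0).deriv, (h4 1 1).deriv]

theorem coord_injective : Function.Injective coord := by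
  intro Z W h
  ext i j
  fin_cases i <;> fin_cases j
  exacts [congrFun h 0, congrFun h 1, congrFun h 2, congrFun h 3]

theorem u2Param_congr (R : ℝ) {s t : Fin 4 → ℝ}
    (h : ∀ k, Complex.exp (s k * Complex.I) = Complex.exp (t k * Complex.I)) (h1 : s 1 = t 1) :
    u2Param R s = u2Param R t := by
  simp only [u2Param, sub_mul, Complex.exp_sub, h, h1]

theorem continuous_dVDensity (R : ℝ) : Continuous (dVDensity R) := by
  have : dVDensity R = fun t => _ := funext (dVDensity_eq R)
  rw [this]
  fun_prop

theorem isCompact_u2Box : IsCompact u2Box := isCompact_Icc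

theorem measurableSet_u2Box : MeasurableSet u2Box := measurableSet_Icc

/-- The divergence theorem on the parameter box for `g` times the vector field with components
`boxChar a t * q j (t 1)`. If this field is divergence free and its push-forward to `HC` is
`dVDensity R • V`, the derivative of `g` along `V` integrates to zero against `dV`. -/
theorem integral_fderiv_of_field (R : ℝ) (g : HC → ℂ)
    (hg : ∀ t ∈ u2Box, ContDiffAt ℂ 1 g (u2Param R t)) (V : HC) (a : Fin 4 → ℤ)
    (q : Fin 4 → ℝ → ℂ) (hq : ∀ j, ContDiff ℝ 1 (q j)) (hq0 : q 1 0 = 0)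
    (hq1 : q 1 (Real.pi / 2) = 0)
    (hdiv : ∀ θ, deriv (q 1) θ + ∑ j, a j * Complex.I * q j θ = 0)
    (hpush : ∀ t i, ∑ j, u2Jacobian R t i j * (boxChar a t * q j (t 1)) =
      dVDensity R t * coord V i) :
    ∫ t in u2Box, fderiv ℂ g (u2Param R t) V * dVDensity R t = 0 := by
  set z := u2Param R with hz
  have hzd : Differentiable ℝ z := (contDiff_u2Param R).differentiable one_ne_zero
  let p1 : (Fin 4 → ℝ) →L[ℝ] ℝ := ContinuousLinearMap.proj 1
  let χ' : (Fin 4 → ℝ) →L[ℝ] ℂ := ∑ j,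
    (Complex.ofRealCLM.comp (ContinuousLinearMap.proj (R := ℝ) (φ := fun _ : Fin 4 => ℝ) j)).smulRight
      (a j * Complex.I)
  let f : Fin 4 → (Fin 4 → ℝ) → ℂ := fun j t => g (z t) * (boxChar a t * q j (t 1))
  let f' : Fin 4 → (Fin 4 → ℝ) → (Fin 4 → ℝ) →L[ℝ] ℂ := fun j t =>
    g (z t) • (boxChar a t • (p1.smulRight (deriv (q j) (t 1))) +
      q j (t 1) • (boxChar a t • χ')) +
    (boxChar a t * q j (t 1)) • (((fderiv ℂ g (z t)).restrictScalars ℝ).comp (fderiv ℝ z t))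
  have hgd : ∀ t ∈ u2Box, HasFDerivAt g (fderiv ℂ g (z t)) (z t) := fun t ht =>
    ((hg t ht).differentiableAt one_ne_zero).hasFDerivAt
  have hf : ∀ t ∈ u2Box, ∀ j, HasFDerivAt (f j) (f' j t) t := by
    intro t ht j
    have h1 : HasFDerivAt (fun t => g (z t))
        (((fderiv ℂ g (z t)).restrictScalars ℝ).comp (fderiv ℝ z t)) t :=
      ((hgd t ht).restrictScalars ℝ).comp t (hzd t).hasFDerivAt
    have h2 : HasFDerivAt (fun t : Fin 4 → ℝ => q j (t 1)) (p1.smulRight (deriv (q j) (t 1))) t := by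
      have h := HasFDerivAt.comp (g := q j) t
        (((hq j).differentiable one_ne_zero) (p1 t)).hasDerivAt.hasFDerivAt p1.hasFDerivAt
      refine h.congr_fderiv ?_
      ext v
      simp [p1]
    exact h1.mul ((hasFDerivAt_boxChar a t).mul h2)
  have hχ' : ∀ j, χ' (Pi.single j 1) = a j * Complex.I := by
    intro j
    simp only [χ', sum_apply]
    rw [Finset.sum_eq_single j]
    · simp
    · intro k _ hk
      simp [hk]
    · simp
  have hsum : ∀ t, ∑ j, f' j t (Pi.single j 1) = fderiv ℂ g (z t) V * dVDensity R t := by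
    intro t
    have h1 : ∑ j, (boxChar a t * q j (t 1)) • fderiv ℝ z t (Pi.single j 1) =
        dVDensity R t • V := by
      apply coord_injective
      ext i
      have h := hpush t i
      simp_rw [← fderiv_u2Param_single] at h
      have hc : ∀ (c : ℂ) (Z : HC), coord (c • Z) i = c * coord Z i := by
        intro c Z; fin_cases i <;> rfl
      have hs : ∀ Z : Fin 4 → HC, coord (∑ j, Z j) i = ∑ j, coord (Z j) i := by
        intro Z; fin_cases i <;> simp [coord, Matrix.sum_apply]
      rw [hs, hc, ← h]
      refine Finset.sum_congr rfl fun j _ => ?_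
      rw [hc, mul_comm]
    have h2 : fderiv ℂ g (z t) V * dVDensity R t =
        ∑ j, (boxChar a t * q j (t 1)) * fderiv ℂ g (z t) (fderiv ℝ z t (Pi.single j 1)) := by
      rw [mul_comm, ← smul_eq_mul, ← map_smul, ← h1, map_sum]
      simp [smul_eq_mul]
    rw [h2]
    have h3 : ∀ j, f' j t (Pi.single j 1) =
        g (z t) * boxChar a t * ((if j = 1 then deriv (q 1) (t 1) else 0) +
          a j * Complex.I * q j (t 1)) +
        (boxChar a t * q j (t 1)) * fderiv ℂ g (z t) (fderiv ℝ z t (Pi.single j 1)) := by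
      intro j
      simp only [f', add_apply, smul_apply, hχ', smul_eq_mul]
      by_cases hj : j = 1
      · subst hj
        simp [p1]
        ring
      · simp [p1, hj, Ne.symm hj]
        ring
    simp_rw [h3]
    rw [Finset.sum_add_distrib, ← Finset.mul_sum, Finset.sum_add_distrib]
    simp [hdiv (t 1)]
  have hcont : ContinuousOn (fun t => fderiv ℂ g (z t) V * dVDensity R t) u2Box := by
    intro t ht
    refine ContinuousAt.continuousWithinAt ?_
    refine ContinuousAt.mul ?_ (continuous_dVDensity R).continuousAt
    have h1 : ContinuousAt (fderiv ℂ g) (z t) :=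
      ((hg t ht).fderiv_right (m := 0) (by norm_num)).continuousAt
    exact (ContinuousAt.comp (f := z) h1 (hzd t).continuousAt).clm_apply continuousAt_const
  have hle : (0 : Fin 4 → ℝ) ≤ ![2 * Real.pi, Real.pi / 2, 2 * Real.pi, 2 * Real.pi] := by
    have := Real.pi_pos
    intro i
    fin_cases i <;> simp <;> positivity
  have key := MeasureTheory.integral_divergence_of_hasFDerivAt_off_countable' 0
    ![2 * Real.pi, Real.pi / 2, 2 * Real.pi, 2 * Real.pi] hle f f' ∅ Set.countable_empty
    (fun j t ht => (hf t ht j).continuousAt.continuousWithinAt)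
    (fun t ht j => hf t (by
      have h := ht.1
      exact ⟨fun i => ((Set.mem_univ_pi.1 h) i).1.le, fun i => ((Set.mem_univ_pi.1 h) i).2.le⟩) j)
    (by
      simp_rw [hsum]
      exact hcont.integrableOn_compact isCompact_u2Box)
  simp_rw [hsum] at key
  -- The faces of the angle `θ = t 1` carry no flux, since there a circle collapses; the remaining
  -- faces cancel in pairs by periodicity.
  refine key.trans (Finset.sum_eq_zero fun j _ => ?_)
  by_cases hj : j = 1
  · subst hj
    simp [f, hq0, hq1]
  · have hper : ∀ x : Fin 3 → ℝ, f j (j.insertNth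
        ((![2 * Real.pi, Real.pi / 2, 2 * Real.pi, 2 * Real.pi] : Fin 4 → ℝ) j) x) =
        f j (j.insertNth ((0 : Fin 4 → ℝ) j) x) := by
      intro x
      have hb : (![2 * Real.pi, Real.pi / 2, 2 * Real.pi, 2 * Real.pi] : Fin 4 → ℝ) j =
          2 * Real.pi := by
        fin_cases j <;> simp at hj ⊢
      rw [hb]
      have h1 : ∀ k, Complex.exp (((j.insertNth (2 * Real.pi) x : Fin 4 → ℝ) k : ℝ) * Complex.I) =
          Complex.exp (((j.insertNth ((0 : Fin 4 → ℝ) j) x : Fin 4 → ℝ) k : ℝ) * Complex.I) := by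
        intro k
        induction k using Fin.succAboveCases j with
        | x => simp
        | p k => simp
      have h2 : (j.insertNth (2 * Real.pi) x : Fin 4 → ℝ) 1 =
          (j.insertNth ((0 : Fin 4 → ℝ) j) x : Fin 4 → ℝ) 1 := by
        obtain ⟨k, hk⟩ := Fin.exists_succAbove_eq (Ne.symm hj)
        rw [← hk, Fin.insertNth_apply_succAbove, Fin.insertNth_apply_succAbove]
      simp only [f, hz]
      rw [u2Param_congr R h1 h2, h2]
      simp only [boxChar, h1]
    simp_rw [hper]
    exact sub_self _

/-- Stokes' theorem on the closed cycle `U(2)_R`, for a coordinate direction. The vector fields on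
the parameter box are the rows of a quarter of the adjugate of the Jacobian matrix; they are
divergence free by the Piola identity. -/
theorem integral_fderiv_single (R : ℝ) (g : HC → ℂ)
    (hg : ∀ t ∈ u2Box, ContDiffAt ℂ 1 g (u2Param R t)) (i j : Fin 2) :
    ∫ t in u2Box, fderiv ℂ g (u2Param R t) (Matrix.single i j 1) * dVDensity R t = 0 := by
  have hs : ContDiff ℝ 1 (fun θ : ℝ => Complex.sin θ) :=
    (Complex.contDiff_sin.restrict_scalars ℝ).comp Complex.ofRealCLM.contDiff
  have hc : ContDiff ℝ 1 (fun θ : ℝ => Complex.cos θ) :=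
    (Complex.contDiff_cos.restrict_scalars ℝ).comp Complex.ofRealCLM.contDiff
  have hds (θ : ℝ) : HasDerivAt (fun θ : ℝ => Complex.sin θ) (Complex.cos θ) θ :=
    (Complex.hasDerivAt_sin (θ : ℂ)).comp_ofReal
  have hdc (θ : ℝ) : HasDerivAt (fun θ : ℝ => Complex.cos θ) (-Complex.sin θ) θ :=
    (Complex.hasDerivAt_cos (θ : ℂ)).comp_ofReal
  have d1 (c : ℂ) (θ : ℝ) : deriv (fun θ : ℝ => c * (Complex.sin θ ^ 2 * Complex.cos θ)) θ =
      c * (2 * Complex.sin θ * Complex.cos θ ^ 2 - Complex.sin θ ^ 3) := by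
    refine ((((hds θ).pow 2).mul (hdc θ)).const_mul c).deriv.trans ?_
    simp only [Nat.cast_ofNat, Nat.add_one_sub_one, pow_one, mul_neg, Pi.pow_apply]
    ring
  have d2 (c : ℂ) (θ : ℝ) : deriv (fun θ : ℝ => c * (Complex.sin θ * Complex.cos θ ^ 2)) θ =
      c * (Complex.cos θ ^ 3 - 2 * Complex.sin θ ^ 2 * Complex.cos θ) := by
    refine (((hds θ).mul ((hdc θ).pow 2)).const_mul c).deriv.trans ?_
    simp only [Nat.cast_ofNat, Nat.add_one_sub_one, pow_one, mul_neg, Pi.pow_apply]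
    ring
  have hE (x y : ℝ) : Complex.exp ((x - y) * Complex.I) =
      Complex.exp (x * Complex.I) * (Complex.exp (y * Complex.I))⁻¹ := by
    rw [sub_mul, Complex.exp_sub, div_eq_mul_inv]
  have hE2 (x : ℝ) : Complex.exp (2 * x * Complex.I) = Complex.exp (x * Complex.I) ^ 2 := by
    rw [← Complex.exp_nat_mul]; push_cast; ring_nf
  have hsc (θ : ℝ) := Complex.sin_sq_add_cos_sq (θ : ℂ)
  have hπ : Complex.cos ((Real.pi / 2 : ℝ) : ℂ) = 0 := by
    rw [← Complex.ofReal_cos, Real.cos_pi_div_two, Complex.ofReal_zero]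
  fin_cases i <;> fin_cases j
  · refine integral_fderiv_of_field R g hg _ ![-1, 0, 0, 2]
      ![fun θ => -(R ^ 3 / 4) * (Complex.sin θ * (1 + Complex.cos θ ^ 2)),
        fun θ => (R ^ 3 * Complex.I / 4) * (Complex.sin θ ^ 2 * Complex.cos θ),
        fun θ => -(R ^ 3 / 4) * (Complex.sin θ * Complex.cos θ ^ 2),
        fun θ => -(R ^ 3 / 2) * (Complex.sin θ * Complex.cos θ ^ 2)] ?_ ?_ ?_ ?_ ?_
    · intro j
      fin_cases j <;> simp [-Complex.ofReal_sin, -Complex.ofReal_cos] <;> fun_prop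
    · simp
    · simp [hπ, -Complex.ofReal_div, -Complex.ofReal_cos]
    · intro θ
      simp [-Complex.ofReal_sin, -Complex.ofReal_cos, Fin.sum_univ_four, d1]
      linear_combination (-(R ^ 3 * Complex.I / 4) * Complex.sin θ) * hsc θ
    · intro t i
      have n0 := Complex.exp_ne_zero (t 0 * Complex.I)
      have n2 := Complex.exp_ne_zero (t 2 * Complex.I)
      have n3 := Complex.exp_ne_zero (t 3 * Complex.I)
      have hsc := eq_sub_of_add_eq' (hsc (t 1))
      rw [u2Jacobian_eq, dVDensity_eq, boxChar, hE2, hE, hE]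
      simp only [Fin.sum_univ_four, Fin.prod_univ_four, Matrix.cons_val]
      generalize Complex.exp (t 0 * Complex.I) = X at *
      generalize Complex.exp (t 2 * Complex.I) = Y at *
      generalize Complex.exp (t 3 * Complex.I) = U at *
      generalize Complex.sin (t 1) = S at *
      generalize Complex.cos (t 1) = C at *
      have h : C ^ 2 = 1 - S ^ 2 := hsc
      fin_cases i <;> simp [coord] <;> field_simp <;> ring_nf
      · linear_combination (-2 * (R : ℂ) ^ 4 * C * S) * h
      · linear_combination (-2 * (R : ℂ) ^ 4 * U ^ 3 * Complex.I * C * S) * h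
  · refine integral_fderiv_of_field R g hg _ ![0, 0, -1, 2]
      ![fun θ => -(R ^ 3 / 4) * (Complex.sin θ ^ 2 * Complex.cos θ),
        fun θ => -(R ^ 3 * Complex.I / 4) * (Complex.sin θ * Complex.cos θ ^ 2),
        fun θ => -(R ^ 3 / 4) * (Complex.cos θ * (1 + Complex.sin θ ^ 2)),
        fun θ => -(R ^ 3 / 2) * (Complex.sin θ ^ 2 * Complex.cos θ)] ?_ ?_ ?_ ?_ ?_
    · intro j
      fin_cases j <;> simp [-Complex.ofReal_sin, -Complex.ofReal_cos] <;> fun_prop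
    · simp
    · simp [hπ, -Complex.ofReal_div, -Complex.ofReal_cos]
    · intro θ
      simp [-Complex.ofReal_sin, -Complex.ofReal_cos, Fin.sum_univ_four, d2]
      linear_combination (-(R ^ 3 * Complex.I / 4) * Complex.cos θ) * hsc θ
    · intro t i
      have n0 := Complex.exp_ne_zero (t 0 * Complex.I)
      have n2 := Complex.exp_ne_zero (t 2 * Complex.I)
      have n3 := Complex.exp_ne_zero (t 3 * Complex.I)
      have hsc := eq_sub_of_add_eq' (hsc (t 1))
      rw [u2Jacobian_eq, dVDensity_eq, boxChar, hE2, hE, hE]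
      simp only [Fin.sum_univ_four, Fin.prod_univ_four, Matrix.cons_val]
      generalize Complex.exp (t 0 * Complex.I) = X at *
      generalize Complex.exp (t 2 * Complex.I) = Y at *
      generalize Complex.exp (t 3 * Complex.I) = U at *
      generalize Complex.sin (t 1) = S at *
      generalize Complex.cos (t 1) = C at *
      have h : C ^ 2 = 1 - S ^ 2 := hsc
      fin_cases i <;> simp [coord] <;> field_simp <;> ring_nf
      · linear_combination (-2 * (R : ℂ) ^ 4 * C * S) * h
      · linear_combination (2 * (R : ℂ) ^ 4 * U ^ 3 * Complex.I * C * S) * h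
  · refine integral_fderiv_of_field R g hg _ ![0, 0, 1, 1]
      ![fun θ => (R ^ 3 / 4) * (Complex.sin θ ^ 2 * Complex.cos θ),
        fun θ => (R ^ 3 * Complex.I / 4) * (Complex.sin θ * Complex.cos θ ^ 2),
        fun θ => -(R ^ 3 / 4) * Complex.cos θ ^ 3,
        fun θ => (R ^ 3 / 2) * (Complex.sin θ ^ 2 * Complex.cos θ)] ?_ ?_ ?_ ?_ ?_
    · intro j
      fin_cases j <;> simp [-Complex.ofReal_sin, -Complex.ofReal_cos] <;> fun_prop
    · simp
    · simp [hπ, -Complex.ofReal_div, -Complex.ofReal_cos]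
    · intro θ
      simp [-Complex.ofReal_sin, -Complex.ofReal_cos, Fin.sum_univ_four, d2]
      linear_combination 0 * hsc θ
    · intro t i
      have n0 := Complex.exp_ne_zero (t 0 * Complex.I)
      have n2 := Complex.exp_ne_zero (t 2 * Complex.I)
      have n3 := Complex.exp_ne_zero (t 3 * Complex.I)
      have hsc := eq_sub_of_add_eq' (hsc (t 1))
      rw [u2Jacobian_eq, dVDensity_eq, boxChar, hE2, hE, hE]
      simp only [Fin.sum_univ_four, Fin.prod_univ_four, Matrix.cons_val]
      generalize Complex.exp (t 0 * Complex.I) = X at *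
      generalize Complex.exp (t 2 * Complex.I) = Y at *
      generalize Complex.exp (t 3 * Complex.I) = U at *
      generalize Complex.sin (t 1) = S at *
      generalize Complex.cos (t 1) = C at *
      have h : C ^ 2 = 1 - S ^ 2 := hsc
      fin_cases i <;> simp [coord] <;> field_simp <;> ring_nf
      linear_combination (-4 * (R : ℂ) ^ 4 * C * S) * h
  · refine integral_fderiv_of_field R g hg _ ![1, 0, 0, 1]
      ![fun θ => (R ^ 3 / 4) * Complex.sin θ ^ 3,
        fun θ => (R ^ 3 * Complex.I / 4) * (Complex.sin θ ^ 2 * Complex.cos θ),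
        fun θ => -(R ^ 3 / 4) * (Complex.sin θ * Complex.cos θ ^ 2),
        fun θ => -(R ^ 3 / 2) * (Complex.sin θ * Complex.cos θ ^ 2)] ?_ ?_ ?_ ?_ ?_
    · intro j
      fin_cases j <;> simp [-Complex.ofReal_sin, -Complex.ofReal_cos] <;> fun_prop
    · simp
    · simp [hπ, -Complex.ofReal_div, -Complex.ofReal_cos]
    · intro θ
      simp [-Complex.ofReal_sin, -Complex.ofReal_cos, Fin.sum_univ_four, d1]
      linear_combination 0 * hsc θ
    · intro t i
      have n0 := Complex.exp_ne_zero (t 0 * Complex.I)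
      have n2 := Complex.exp_ne_zero (t 2 * Complex.I)
      have n3 := Complex.exp_ne_zero (t 3 * Complex.I)
      have hsc := eq_sub_of_add_eq' (hsc (t 1))
      rw [u2Jacobian_eq, dVDensity_eq, boxChar, hE2, hE, hE]
      simp only [Fin.sum_univ_four, Fin.prod_univ_four, Matrix.cons_val]
      generalize Complex.exp (t 0 * Complex.I) = X at *
      generalize Complex.exp (t 2 * Complex.I) = Y at *
      generalize Complex.exp (t 3 * Complex.I) = U at *
      generalize Complex.sin (t 1) = S at *
      generalize Complex.cos (t 1) = C at *
      have h : C ^ 2 = 1 - S ^ 2 := hsc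
      fin_cases i <;> simp [coord] <;> field_simp <;> ring_nf
      linear_combination (-4 * (R : ℂ) ^ 4 * C * S) * h

end HC

/-! ### Homogeneous coordinates and conformal weights -/

/-- Homogeneous coordinates on the space of `Y ∈ HC`: the class of `(P, Q)` under right
multiplication by invertible matrices stands for `P Q⁻¹`. -/
abbrev HV : Type := Matrix (Fin 2 ⊕ Fin 2) (Fin 2) ℂ

/-- Complex `4 × 4` matrices in `2 × 2` blocks. -/
abbrev M4 : Type := Matrix (Fin 2 ⊕ Fin 2) (Fin 2 ⊕ Fin 2) ℂ

namespace HV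

/-- The pairing of homogeneous coordinates which becomes `N(Y - Y')` in affine coordinates. -/
noncomputable def bracket (u v : HV) : ℂ := (Matrix.fromCols u v).det

/-- The homogeneous coordinates `(Y, 1)` of `Y`. -/
def aff (Y : HC) : HV := Matrix.fromRows Y 1

theorem bracket_mul_left (A : M4) (u v : HV) :
    bracket (A * u) (A * v) = A.det * bracket u v := by
  rw [bracket, ← Matrix.mul_fromCols, Matrix.det_mul, bracket]

theorem bracket_mul_right (u v : HV) (g g' : HC) :
    bracket (u * g) (v * g') = g.det * g'.det * bracket u v := by
  have h : Matrix.fromCols (u * g) (v * g') =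
      Matrix.fromCols u v * Matrix.fromBlocks g 0 0 g' := by
    rw [Matrix.fromCols_mul_fromBlocks]; simp
  rw [bracket, h, Matrix.det_mul, Matrix.det_fromBlocks_zero₂₁, bracket]
  ring

theorem bracket_aff_aff (Y Y' : HC) : bracket (aff Y) (aff Y') = HC.N (Y - Y') := by
  rw [bracket, aff, aff, Matrix.fromCols_fromRows_eq_fromBlocks, Matrix.det_fromBlocks_one₂₂,
    HC.N, mul_one]

theorem bracket_comm (u v : HV) : bracket u v = bracket v u := by
  have h : Matrix.fromCols v u =
      (Matrix.fromCols u v).submatrix id (Equiv.sumComm (Fin 2) (Fin 2)) := by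
    ext i j
    rcases j with j | j <;> rfl
  have hs : Equiv.Perm.sign (Equiv.sumComm (Fin 2) (Fin 2)) = 1 := by decide
  rw [bracket, bracket, h, Matrix.det_permute', hs]
  simp

/-- A singular pairing with `(T, 1)` yields a vector on which `u` has the same quotient as `T`. -/
theorem exists_mulVec_of_bracket_aff_eq_zero {u : HV} {T : HC} (h : bracket u (aff T) = 0) :
    ∃ x : Fin 2 → ℂ, x ≠ 0 ∧ u.toRows₁ *ᵥ x = T *ᵥ (u.toRows₂ *ᵥ x) := by
  obtain ⟨y, hy0, hy⟩ := Matrix.exists_mulVec_eq_zero_iff.2 h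
  rw [Matrix.fromCols_mulVec] at hy
  have h1 : u.toRows₁ *ᵥ (y ∘ Sum.inl) + T *ᵥ (y ∘ Sum.inr) = 0 := by
    ext i
    exact congrFun hy (Sum.inl i)
  have h2 : u.toRows₂ *ᵥ (y ∘ Sum.inl) + y ∘ Sum.inr = 0 := by
    ext i
    have := congrFun hy (Sum.inr i)
    rw [← Matrix.one_mulVec (y ∘ Sum.inr)]
    exact this
  have h3 : y ∘ Sum.inr = -(u.toRows₂ *ᵥ (y ∘ Sum.inl)) := eq_neg_of_add_eq_zero_right h2
  refine ⟨y ∘ Sum.inl, fun h0 => hy0 ?_, ?_⟩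
  · rw [h0, Matrix.mulVec_zero, neg_zero] at h3
    ext i
    rcases i with i | i
    exacts [congrFun h0 i, congrFun h3 i]
  · rw [h3, Matrix.mulVec_neg] at h1
    exact sub_eq_zero.1 (by rw [sub_eq_add_neg]; exact h1)

end HV

namespace BoxDiagram

/-- The product over the edges of `d` of a function `b` of their end points: the dashed edges
contribute `b`, the solid ones `b⁻¹`. -/
noncomputable def edgeProd {n : ℕ} (d : BoxDiagram n) (b : Vertex n → Vertex n → ℂ) : ℂ :=
  (d.dashed.map fun p => b p.1 p.2).prod * (d.solid.map fun p => (b p.1 p.2)⁻¹).prod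

theorem edgeProd_sling {n : ℕ} (e : External) (d : BoxDiagram n)
    (b : Vertex (n + 1) → Vertex (n + 1) → ℂ) :
    (sling e d).edgeProd b =
      b (.ext e.nbrs.1) (.ext e.nbrs.2) *
      ((b (Vertex.leg (Fin.last n) e).1 (Vertex.leg (Fin.last n) e).2)⁻¹ *
      (b (Vertex.leg (Fin.last n) e.nbrs.1).1 (Vertex.leg (Fin.last n) e.nbrs.1).2)⁻¹ *
      (b (Vertex.leg (Fin.last n) e.nbrs.2).1 (Vertex.leg (Fin.last n) e.nbrs.2).2)⁻¹) *
      d.edgeProd fun p q => b (p.relabel e) (q.relabel e) := by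
  simp only [edgeProd, dashed, solid, List.map_cons, List.prod_cons, List.map_map,
    Function.comp_def, Prod.map_fst, Prod.map_snd]
  ring

/-- Conformal weights of a diagram: there are `2 n + 2` more solid than dashed edges, and the
excess of solid over dashed edges is `1` at an external vertex and `4` at a solid vertex. -/
theorem edgeProd_scale {n : ℕ} (d : BoxDiagram n) (b b' : Vertex n → Vertex n → ℂ) {c : ℂ}
    (hc : c ≠ 0) (κ : Vertex n → ℂ) (hκ : ∀ v, κ v ≠ 0)
    (hb : ∀ p q, b' p q = c * κ p * κ q * b p q) :
    d.edgeProd b' = (c ^ (2 * n + 2))⁻¹ *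
      (κ (.ext .Z₁) * κ (.ext .Z₂) * κ (.ext .W₁) * κ (.ext .W₂))⁻¹ *
      (∏ k, κ (.T k) ^ 4)⁻¹ * d.edgeProd b := by
  induction d with
  | oneLoop =>
    simp only [edgeProd, dashed, solid, List.map_cons, List.map_nil, List.prod_cons, List.prod_nil,
      hb, Vertex.leg, Finset.univ_unique, Finset.prod_singleton, mul_inv, Fin.default_eq_zero]
    ring
  | @sling n e d ih =>
    rw [edgeProd_sling, edgeProd_sling, ih (fun p q => b (p.relabel e) (q.relabel e))
      (fun p q => b' (p.relabel e) (q.relabel e)) (fun p => κ (p.relabel e)) (fun _ => hκ _)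
      (fun _ _ => hb _ _), Fin.prod_univ_castSucc]
    have hZ1 := hκ (.ext .Z₁)
    have hZ2 := hκ (.ext .Z₂)
    have hW1 := hκ (.ext .W₁)
    have hW2 := hκ (.ext .W₂)
    have hT := hκ (.T (Fin.last n))
    have hc4 : c ^ (2 * (n + 1) + 2) = c ^ (2 * n + 2) * c ^ 2 := by ring
    have hP : (∏ k : Fin n, κ (.T k.castSucc) ^ 4) ≠ 0 :=
      Finset.prod_ne_zero_iff.2 fun k _ => pow_ne_zero _ (hκ _)
    rw [hc4]
    cases e <;> simp only [External.nbrs, Vertex.leg, Vertex.relabel, hb, reduceCtorEq, if_false,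
      if_true, mul_inv] <;> field_simp

theorem integrand_eq_edgeProd {n : ℕ} (d : BoxDiagram n) (X : External → HC) (T : Fin n → HC) :
    d.integrand X T = d.edgeProd fun p q => HC.N (value X T p - value X T q) := rfl

/-- Every solid edge joins two solid vertices, a solid vertex to some `Zᵢ` above it, or a solid
vertex to some `Wᵢ` below it. -/
theorem solid_cases {n : ℕ} (d : BoxDiagram n) {p : Vertex n × Vertex n} (hp : p ∈ d.solid) :
    (∃ i j, p = (.T i, .T j)) ∨ (∃ k, p = (.T k, .ext .Z₁) ∨ p = (.T k, .ext .Z₂)) ∨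
      ∃ k, p = (.ext .W₁, .T k) ∨ p = (.ext .W₂, .T k) := by
  induction d with
  | oneLoop =>
    simp only [solid, Vertex.leg, List.mem_cons, List.not_mem_nil, or_false] at hp
    rcases hp with rfl | rfl | rfl | rfl <;> simp
  | @sling n e d ih =>
    have hleg : ∀ (k : Fin (n + 1)) e', (∃ k', Vertex.leg k e' = (.T k', .ext .Z₁) ∨
        Vertex.leg k e' = (.T k', .ext .Z₂)) ∨
        ∃ k', Vertex.leg k e' = (.ext .W₁, .T k') ∨ Vertex.leg k e' = (.ext .W₂, .T k') := by
      intro k e'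
      cases e' <;> simp [Vertex.leg]
    simp only [solid, List.mem_cons, List.mem_map] at hp
    rcases hp with rfl | rfl | rfl | ⟨q, hq, rfl⟩
    · exact Or.inr (hleg _ _)
    · exact Or.inr (hleg _ _)
    · exact Or.inr (hleg _ _)
    · rcases ih hq with ⟨i, j, rfl⟩ | ⟨k, rfl | rfl⟩ | ⟨k, rfl | rfl⟩ <;>
        cases e <;> simp [Vertex.relabel]

theorem eq_Z_of_mem_solid {n : ℕ} (d : BoxDiagram n) {k : Fin n} {e : External}
    (h : (Vertex.T k, Vertex.ext e) ∈ d.solid) : e = .Z₁ ∨ e = .Z₂ := by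
  simpa [exists_or] using d.solid_cases h

theorem eq_W_of_mem_solid {n : ℕ} (d : BoxDiagram n) {k : Fin n} {e : External}
    (h : (Vertex.ext e, Vertex.T k) ∈ d.solid) : e = .W₁ ∨ e = .W₂ := by
  simpa [exists_or] using d.solid_cases h

end BoxDiagram

/-! ### The integrand and its infinitesimal covariance -/

instance : Fintype External := ⟨{.Z₁, .Z₂, .W₁, .W₂}, fun x => by cases x <;> simp⟩

/-- Homogeneous coordinates at all the vertices of a diagram with `n` loops. -/
abbrev HW (n : ℕ) : Type := (External → HV) × (Fin n → HV)

namespace HV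

theorem contDiff_bracket : ContDiff ℂ 1 fun p : HV × HV => bracket p.1 p.2 := by
  have he (i : Fin 2 ⊕ Fin 2) (j : Fin 2) : ContDiff ℂ 1 fun u : HV => u i j :=
    contDiff_pi.1 (contDiff_pi.1 contDiff_id i) j
  simp only [bracket, Matrix.det_apply]
  refine ContDiff.sum fun σ _ => ContDiff.const_smul _ (contDiff_prod fun i _ => ?_)
  rcases i with i | i
  · exact (he _ i).comp contDiff_fst
  · exact (he _ i).comp contDiff_snd

end HV

namespace BoxDiagram

open HV

variable {n : ℕ}

/-- The homogeneous coordinates at a vertex. -/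
def vert (w : HW n) : Vertex n → HV
  | .ext e => w.1 e
  | .T k => w.2 k

/-- The rational function of a diagram in homogeneous coordinates. -/
noncomputable def kernel (d : BoxDiagram n) (w : HW n) : ℂ :=
  d.edgeProd fun p q => bracket (vert w p) (vert w q)

/-- The configurations at which no solid edge of the diagram is singular. -/
def regular (d : BoxDiagram n) : Set (HW n) :=
  {w | ∀ p ∈ d.solid, bracket (vert w p.1) (vert w p.2) ≠ 0}

theorem contDiff_vert (p : Vertex n) : ContDiff ℂ 1 fun w : HW n => vert w p := by
  cases p with
  | ext e => exact contDiff_pi.1 contDiff_fst _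
  | T k => exact contDiff_pi.1 contDiff_snd _

theorem contDiff_bracket_vert (p q : Vertex n) :
    ContDiff ℂ 1 fun w : HW n => bracket (vert w p) (vert w q) :=
  ContDiff.comp (g := fun p : HV × HV => bracket p.1 p.2)
    (f := fun w : HW n => (vert w p, vert w q)) contDiff_bracket
    ((contDiff_vert p).prodMk (contDiff_vert q))

theorem isOpen_regular (d : BoxDiagram n) : IsOpen d.regular := by
  have h : d.regular = ⋂ p ∈ {p | p ∈ d.solid}, {w | bracket (vert w p.1) (vert w p.2) ≠ 0} := by
    ext w
    simp [regular]
  rw [h]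
  exact (List.finite_toSet d.solid).isOpen_biInter fun p _ =>
    isOpen_ne_fun (contDiff_bracket_vert _ _).continuous continuous_const

theorem contDiffAt_list_map_prod {E ι : Type*} [NormedAddCommGroup E] [NormedSpace ℂ E] {x : E}
    (l : List ι) (f : ι → E → ℂ) (hf : ∀ i ∈ l, ContDiffAt ℂ 1 (f i) x) :
    ContDiffAt ℂ 1 (fun y => (l.map fun i => f i y).prod) x := by
  induction l with
  | nil => simpa using contDiffAt_const
  | cons i l ih =>
    simp only [List.map_cons, List.prod_cons]
    exact (hf i (by simp)).mul (ih fun j hj => hf j (by simp [hj]))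

theorem contDiffAt_kernel (d : BoxDiagram n) {w : HW n} (hw : w ∈ d.regular) :
    ContDiffAt ℂ 1 d.kernel w :=
  (contDiffAt_list_map_prod _ _ fun p _ => (contDiff_bracket_vert p.1 p.2).contDiffAt).mul
    (contDiffAt_list_map_prod _ _ fun p hp =>
      (contDiff_bracket_vert p.1 p.2).contDiffAt.inv (hw p hp))

/-- The simultaneous action of a `4 × 4` matrix on all homogeneous coordinates. -/
def act (A : M4) (w : HW n) : HW n := (fun e => A * w.1 e, fun k => A * w.2 k)

theorem vert_act (A : M4) (w : HW n) (p : Vertex n) : vert (act A w) p = A * vert w p := by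
  cases p <;> rfl

theorem kernel_act (d : BoxDiagram n) {A : M4} (hA : A.det ≠ 0) (w : HW n) :
    d.kernel (act A w) = (A.det ^ (2 * n + 2))⁻¹ * d.kernel w := by
  rw [kernel, d.edgeProd_scale (fun p q => bracket (vert w p) (vert w q)) _ hA (fun _ => 1)
    (fun _ => one_ne_zero) (fun p q => by rw [vert_act, vert_act, bracket_mul_left]; ring)]
  simp [kernel]

theorem kernel_mul_right (d : BoxDiagram n) (w : HW n) (g : External → HC) (g' : Fin n → HC)
    (hg : ∀ e, (g e).det ≠ 0) (hg' : ∀ k, (g' k).det ≠ 0) :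
    d.kernel (fun e => w.1 e * g e, fun k => w.2 k * g' k) =
      ((g .Z₁).det * (g .Z₂).det * (g .W₁).det * (g .W₂).det)⁻¹ * (∏ k, (g' k).det ^ 4)⁻¹ *
      d.kernel w := by
  let κ : Vertex n → ℂ := fun v => match v with
    | .ext e => (g e).det
    | .T k => (g' k).det
  have hκ : ∀ v, κ v ≠ 0 := by
    rintro (e | k)
    exacts [hg e, hg' k]
  rw [kernel, d.edgeProd_scale (fun p q => bracket (vert w p) (vert w q)) _ one_ne_zero κ hκ]
  · simp [kernel, κ]
  · rintro (p | p) (q | q) <;> simp [vert, κ, bracket_mul_right]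

/-- Derivative of `A ↦ det A` at the identity. -/
theorem hasDerivAt_det_one_add_smul {ι : Type*} [Fintype ι] [DecidableEq ι] (M : Matrix ι ι ℂ) :
    HasDerivAt (fun τ : ℂ => (1 + τ • M).det) M.trace 0 := by
  have h : (fun τ : ℂ => (1 + τ • M).det) = fun τ => 1 + M.trace * τ +
      (1 + (Polynomial.X : Polynomial ℂ) • M.map Polynomial.C).det.divX.divX.eval τ * τ ^ 2 :=
    funext fun τ => Matrix.det_one_add_smul τ M
  rw [h]
  refine ((((hasDerivAt_id (0 : ℂ)).const_mul M.trace).const_add 1).add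
    ((Polynomial.hasDerivAt _ 0).mul ((hasDerivAt_id (0 : ℂ)).pow 2))).congr_deriv ?_
  simp

/-- A function which scales by `det ^ (-m)` along `x + τ v` has derivative `-m tr M` times its
value in the direction `v`. -/
theorem fderiv_eq_of_scale {E ι : Type*} [NormedAddCommGroup E] [NormedSpace ℂ E] [Fintype ι]
    [DecidableEq ι] {f : E → ℂ} {x v : E} (hf : DifferentiableAt ℂ f x) (M : Matrix ι ι ℂ) (m : ℕ)
    (h : ∀ τ : ℂ, (1 + τ • M).det ≠ 0 → f (x + τ • v) = ((1 + τ • M).det ^ m)⁻¹ * f x) :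
    fderiv ℂ f x v = -(m * M.trace) * f x := by
  rw [← hf.lineDeriv_eq_fderiv]
  have hd := hasDerivAt_det_one_add_smul M
  have h0 : (1 + (0 : ℂ) • M).det = 1 := by simp
  have hne : ∀ᶠ τ : ℂ in 𝓝 0, (1 + τ • M).det ≠ 0 :=
    hd.continuousAt.eventually_ne (by rw [h0]; exact one_ne_zero)
  have h1 : HasDerivAt (fun τ : ℂ => ((1 + τ • M).det ^ m)⁻¹ * f x) (-(m * M.trace) * f x) 0 := by
    refine (((hd.pow m).inv (by simp)).mul_const (f x)).congr_deriv ?_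
    simp
  exact (h1.congr_of_eventuallyEq (hne.mono h)).deriv

/-- Invariance of the kernel under `GL(4)`, infinitesimally. -/
theorem fderiv_kernel_act (d : BoxDiagram n) {w : HW n} (hw : w ∈ d.regular) (ξ : M4) :
    fderiv ℂ d.kernel w (act ξ w) = -((2 * n + 2 : ℕ) * ξ.trace) * d.kernel w := by
  refine fderiv_eq_of_scale ((d.contDiffAt_kernel hw).differentiableAt one_ne_zero) ξ _ ?_
  intro τ hτ
  rw [← d.kernel_act hτ]
  congr 1
  refine Prod.ext ?_ ?_ <;> funext <;> simp [act, Matrix.add_mul]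

/-- Homogeneity of the kernel in the coordinates of a solid vertex, infinitesimally. -/
theorem fderiv_kernel_mul_right (d : BoxDiagram n) {w : HW n} (hw : w ∈ d.regular) (k : Fin n)
    (M : HC) : fderiv ℂ d.kernel w (0, Pi.single k (w.2 k * M)) =
      -((4 : ℕ) * M.trace) * d.kernel w := by
  refine fderiv_eq_of_scale ((d.contDiffAt_kernel hw).differentiableAt one_ne_zero) M _ ?_
  intro τ hτ
  have h := d.kernel_mul_right w (fun _ => 1) (fun j => if j = k then 1 + τ • M else 1)
    (by simp) (by intro j; by_cases hj : j = k <;> simp [hj, hτ])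
  have hp : ∏ j, (if j = k then 1 + τ • M else (1 : HC)).det ^ 4 = (1 + τ • M).det ^ 4 := by
    rw [Finset.prod_eq_single k]
    · simp
    · intro j _ hj
      simp [hj]
    · simp
  rw [hp] at h
  simp only [Matrix.det_one, mul_one, inv_one, one_mul] at h
  rw [← h]
  congr 1
  refine Prod.ext ?_ ?_
  · simp
  · funext j
    by_cases hj : j = k
    · subst hj
      simp [Matrix.mul_add]
    · simp [hj]

/-- The vector field on `HC` induced by an infinitesimal fractional linear transformation. -/
def field (ξ : M4) (Z : HC) : HC :=
  ξ.toBlocks₁₁ * Z + ξ.toBlocks₁₂ - Z * (ξ.toBlocks₂₁ * Z + ξ.toBlocks₂₂)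

/-- The divergence of `field ξ`. -/
def fieldDiv (ξ : M4) (Z : HC) : ℂ :=
  2 * ξ.toBlocks₁₁.trace - 4 * (ξ.toBlocks₂₁ * Z).trace - 2 * ξ.toBlocks₂₂.trace

/-- Up to a change of the homogeneous coordinates of `Z`, the matrix `ξ` moves `Z` along
`field ξ`. -/
theorem mul_aff (ξ : M4) (Z : HC) :
    ξ * aff Z = aff Z * (ξ.toBlocks₂₁ * Z + ξ.toBlocks₂₂) + Matrix.fromRows (field ξ Z) 0 := by
  conv_lhs => rw [← Matrix.fromBlocks_toBlocks ξ, aff, Matrix.fromBlocks_mul_fromRows]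
  rw [aff, Matrix.fromRows_mul]
  ext (i | i) j <;> simp [field]

theorem trace_eq_toBlocks (ξ : M4) : ξ.trace = ξ.toBlocks₁₁.trace + ξ.toBlocks₂₂.trace := by
  simp [Matrix.trace, Matrix.toBlocks₁₁, Matrix.toBlocks₂₂]

/-- The infinitesimal form of conformal covariance of the integrand: moving the external points
by `ξ` changes it by `-2 tr ξ` and by a divergence in the variables at the solid vertices. -/
theorem fderiv_kernel_external (d : BoxDiagram n) {u : External → HV} {T : Fin n → HC}
    (hw : ((u, fun k => aff (T k)) : HW n) ∈ d.regular) (ξ : M4) :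
    fderiv ℂ d.kernel (u, fun k => aff (T k)) (fun e => ξ * u e, 0) =
      -(2 * ξ.trace) * d.kernel (u, fun k => aff (T k)) -
      ∑ k, (fderiv ℂ d.kernel (u, fun k => aff (T k))
          (0, Pi.single k (Matrix.fromRows (field ξ (T k)) 0)) +
        fieldDiv ξ (T k) * d.kernel (u, fun k => aff (T k))) := by
  set w : HW n := (u, fun k => aff (T k)) with hwdef
  have hdir : act ξ w = (fun e => ξ * u e, 0) + ∑ k : Fin n,
      ((0, Pi.single k (w.2 k * (ξ.toBlocks₂₁ * T k + ξ.toBlocks₂₂))) +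
        ((0, Pi.single k (Matrix.fromRows (field ξ (T k)) 0)) : HW n)) := by
    have h1 : ∑ k : Fin n, ((0, Pi.single k (w.2 k * (ξ.toBlocks₂₁ * T k + ξ.toBlocks₂₂))) +
        ((0, Pi.single k (Matrix.fromRows (field ξ (T k)) 0)) : HW n)) =
        (0, fun k => ξ * aff (T k)) := by
      refine Prod.ext ?_ ?_
      · simp [Prod.fst_sum]
      · rw [Prod.snd_sum, ← Finset.univ_sum_single (fun k => ξ * aff (T k))]
        refine Finset.sum_congr rfl fun k _ => ?_
        rw [mul_aff, Pi.single_add]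
        rfl
    rw [h1]
    refine Prod.ext ?_ ?_
    · simp [act, hwdef]
    · simp [act, hwdef]
  have h2 := d.fderiv_kernel_act hw ξ
  rw [hdir, map_add, map_sum] at h2
  simp_rw [map_add, d.fderiv_kernel_mul_right hw] at h2
  rw [eq_sub_of_add_eq h2]
  have h3 : ∀ k, fieldDiv ξ (T k) = 2 * ξ.trace -
      (4 : ℕ) * (ξ.toBlocks₂₁ * T k + ξ.toBlocks₂₂).trace := by
    intro k
    rw [fieldDiv, Matrix.trace_add, trace_eq_toBlocks]
    push_cast
    ring
  simp_rw [h3]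
  rw [Finset.sum_add_distrib, Finset.sum_add_distrib, ← Finset.sum_mul, ← Finset.sum_mul,
    Finset.sum_sub_distrib, Finset.sum_neg_distrib]
  simp
  ring

end BoxDiagram

/-! ### Stokes' theorem for conformal vector fields -/

namespace BoxDiagram

open HV

theorem contDiff_field_apply (ξ : M4) (i j : Fin 2) : ContDiff ℂ 1 fun Z => field ξ Z i j := by
  have he (a b : Fin 2) : ContDiff ℂ 1 fun Z : HC => Z a b :=
    contDiff_pi.1 (contDiff_pi.1 contDiff_id a) b
  simp only [field, Matrix.sub_apply, Matrix.add_apply, Matrix.mul_apply, Fin.sum_univ_two]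
  fun_prop

theorem fderiv_field_apply (ξ : M4) (Z V : HC) (i j : Fin 2) :
    fderiv ℂ (fun Z => field ξ Z i j) Z V = (ξ.toBlocks₁₁ * V -
      V * (ξ.toBlocks₂₁ * Z + ξ.toBlocks₂₂) - Z * ξ.toBlocks₂₁ * V) i j := by
  refine (((contDiff_field_apply ξ i j).differentiable one_ne_zero) Z).lineDeriv_eq_fderiv.symm
    |>.trans ?_
  have h : ∀ τ : ℂ, field ξ (Z + τ • V) = field ξ Z + τ • (ξ.toBlocks₁₁ * V -
      V * (ξ.toBlocks₂₁ * Z + ξ.toBlocks₂₂) - Z * ξ.toBlocks₂₁ * V) -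
      τ ^ 2 • (V * ξ.toBlocks₂₁ * V) := by
    intro τ
    simp only [field, mul_add, add_mul, smul_add, smul_sub, mul_smul_comm, smul_mul_assoc,
      mul_assoc, smul_smul, pow_two]
    abel
  have h1 : (fun τ : ℂ => field ξ (Z + τ • V) i j) = fun τ => field ξ Z i j +
      τ * (ξ.toBlocks₁₁ * V - V * (ξ.toBlocks₂₁ * Z + ξ.toBlocks₂₂) - Z * ξ.toBlocks₂₁ * V) i j -
      τ ^ 2 * (V * ξ.toBlocks₂₁ * V) i j := by
    funext τ
    rw [h]
    rfl
  rw [lineDeriv, h1]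
  refine ((((hasDerivAt_id (0 : ℂ)).mul_const _).const_add _).sub
    (((hasDerivAt_id (0 : ℂ)).pow 2).mul_const _)).deriv.trans ?_
  simp

theorem sum_fderiv_field (ξ : M4) (Z : HC) :
    ∑ i, ∑ j, fderiv ℂ (fun Z => field ξ Z i j) Z (Matrix.single i j 1) = fieldDiv ξ Z := by
  simp only [fderiv_field_apply, fieldDiv, Matrix.trace_fin_two, Fin.sum_univ_two,
    Matrix.sub_apply, Matrix.add_apply, Matrix.mul_apply, Matrix.single_apply]
  simp
  ring

/-- Stokes' theorem on `U(2)_R` for the vector field of an infinitesimal conformal map. -/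
theorem integral_field (ξ : M4) (R : ℝ) (g : HC → ℂ)
    (hg : ∀ t ∈ HC.u2Box, ContDiffAt ℂ 1 g (HC.u2Param R t)) :
    ∫ t in HC.u2Box, (fderiv ℂ g (HC.u2Param R t) (field ξ (HC.u2Param R t)) +
      fieldDiv ξ (HC.u2Param R t) * g (HC.u2Param R t)) * HC.dVDensity R t = 0 := by
  have hge : ∀ i j, ∀ t ∈ HC.u2Box,
      ContDiffAt ℂ 1 (fun Z => g Z * field ξ Z i j) (HC.u2Param R t) := fun i j t ht =>
    (hg t ht).mul (contDiff_field_apply ξ i j).contDiffAt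
  have hz := (HC.contDiff_u2Param R).continuous
  have hint : ∀ i j, MeasureTheory.Integrable (fun t => fderiv ℂ (fun Z => g Z * field ξ Z i j)
      (HC.u2Param R t) (Matrix.single i j 1) * HC.dVDensity R t)
      (MeasureTheory.volume.restrict HC.u2Box) := by
    intro i j
    refine ContinuousOn.integrableOn_compact HC.isCompact_u2Box (fun t ht => ?_)
    refine ContinuousAt.continuousWithinAt ?_
    refine ContinuousAt.mul ?_ (HC.continuous_dVDensity R).continuousAt
    have h1 : ContinuousAt (fderiv ℂ fun Z => g Z * field ξ Z i j) (HC.u2Param R t) :=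
      ((hge i j t ht).fderiv_right (m := 0) (by norm_num)).continuousAt
    exact (ContinuousAt.comp (f := HC.u2Param R) h1 hz.continuousAt).clm_apply continuousAt_const
  have hsum : ∑ i, ∑ j, ∫ t in HC.u2Box, fderiv ℂ (fun Z => g Z * field ξ Z i j)
      (HC.u2Param R t) (Matrix.single i j 1) * HC.dVDensity R t = 0 :=
    Finset.sum_eq_zero fun i _ => Finset.sum_eq_zero fun j _ =>
      HC.integral_fderiv_single R _ (hge i j) i j
  rw [← hsum]
  simp_rw [← MeasureTheory.integral_finsetSum Finset.univ fun j _ => hint _ j]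
  rw [← MeasureTheory.integral_finsetSum Finset.univ fun i _ =>
    MeasureTheory.integrable_finsetSum Finset.univ fun j _ => hint i j]
  refine MeasureTheory.setIntegral_congr_fun HC.measurableSet_u2Box fun t ht => ?_
  set Z := HC.u2Param R t with hZ
  have h1 : ∀ i j, fderiv ℂ (fun Z => g Z * field ξ Z i j) Z (Matrix.single i j 1) =
      g Z * fderiv ℂ (fun Z => field ξ Z i j) Z (Matrix.single i j 1) +
      fderiv ℂ g Z (Matrix.single i j (field ξ Z i j)) := by
    intro i j
    have h2 : Matrix.single i j (field ξ Z i j) = field ξ Z i j • (Matrix.single i j 1 : HC) := by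
      simp
    have h3 := ((hg t ht).differentiableAt one_ne_zero).hasFDerivAt.mul
      ((contDiff_field_apply ξ i j).differentiable one_ne_zero Z).hasFDerivAt
    rw [h2, map_smul]
    exact congrArg (fun φ => φ (Matrix.single i j 1)) h3.fderiv
  have h3 : fderiv ℂ g Z (field ξ Z) =
      ∑ i, ∑ j, fderiv ℂ g Z (Matrix.single i j (field ξ Z i j)) := by
    conv_lhs => rw [Matrix.matrix_eq_sum_single (field ξ Z)]
    simp only [map_sum]
  simp only [h1]
  simp_rw [← Finset.sum_mul, Finset.sum_add_distrib, ← Finset.mul_sum]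
  rw [h3, sum_fderiv_field]
  ring

end BoxDiagram

namespace HC

open MeasureTheory

/-- An integral over a product of boxes vanishes if it does so in one of the variables. -/
theorem integral_pi_u2Box_eq_zero {n : ℕ} (k : Fin n) (G : (Fin n → Fin 4 → ℝ) → ℂ)
    (hG : ∀ t ∈ Set.univ.pi (fun _ : Fin n => u2Box),
      ∫ s in u2Box, G (Function.update t k s) = 0) :
    ∫ t in Set.univ.pi (fun _ : Fin n => u2Box), G t = 0 := by
  obtain ⟨m, rfl⟩ : ∃ m, n = m + 1 := ⟨n - 1, by have := k.pos; omega⟩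
  have hne : u2Box.Nonempty := ⟨0, by
    have := Real.pi_pos
    refine ⟨le_rfl, fun i => ?_⟩
    fin_cases i <;> simp <;> positivity⟩
  obtain ⟨s₀, hs₀⟩ := hne
  rw [volume_pi, Measure.restrict_pi_pi]
  have hmp := (measurePreserving_piFinSuccAbove
    (fun _ : Fin (m + 1) => (volume : Measure (Fin 4 → ℝ)).restrict u2Box) k).symm
  rw [← hmp.integral_comp']
  -- If `G` is not integrable, its integral is zero by convention.
  by_cases hint : Integrable (fun x => G ((MeasurableEquiv.piFinSuccAbove
      (fun _ : Fin (m + 1) => Fin 4 → ℝ) k).symm x))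
      (((volume : Measure (Fin 4 → ℝ)).restrict u2Box).prod
        (Measure.pi fun _ : Fin m => (volume : Measure (Fin 4 → ℝ)).restrict u2Box))
  · rw [integral_prod_symm _ hint]
    rw [← Measure.restrict_pi_pi, ← volume_pi]
    rw [setIntegral_congr_fun (MeasurableSet.univ_pi fun _ => measurableSet_u2Box)
      (g := fun _ => (0 : ℂ))]
    · simp
    · intro y hy
      have h := hG (k.insertNth s₀ y) (by
        intro i _
        induction i using Fin.succAboveCases k with
        | x => simpa using hs₀
        | p i => simpa using hy i trivial)
      simpa [MeasurableEquiv.piFinSuccAbove, Fin.insertNthEquiv, Fin.update_insertNth] using h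
  · exact integral_undef hint

end HC

/-! ### The derivative of the box integral -/

namespace BoxDiagram

open HV MeasureTheory

variable {n : ℕ}

/-- The box parametrising `U(2)_{r₁} × ⋯ × U(2)_{rₙ}`. -/
noncomputable def multiBox (n : ℕ) : Set (Fin n → Fin 4 → ℝ) := Set.univ.pi fun _ => HC.u2Box

/-- The configuration with external points `u` and solid vertices on the cycles at parameter `t`. -/
noncomputable def config (r : Fin n → ℝ) (u : External → HV) (t : Fin n → Fin 4 → ℝ) : HW n :=
  (u, fun k => aff (HC.u2Param (r k) (t k)))

/-- The density of `dV_{T₁} ⋯ dV_{Tₙ}`. -/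
noncomputable def density (r : Fin n → ℝ) (t : Fin n → Fin 4 → ℝ) : ℂ :=
  ∏ k, HC.dVDensity (r k) (t k)

/-- The box integral as a function of the homogeneous coordinates of the external points. -/
noncomputable def homIntegral (d : BoxDiagram n) (r : Fin n → ℝ) (u : External → HV) : ℂ :=
  ∫ t in multiBox n, d.kernel (config r u t) * density r t

/-- The external points for which the integrand has no pole on the cycle of integration. -/
def good (d : BoxDiagram n) (r : Fin n → ℝ) : Set (External → HV) :=
  {u | ∀ t ∈ multiBox n, config r u t ∈ d.regular}

theorem isCompact_multiBox : IsCompact (multiBox n) :=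
  isCompact_univ_pi fun _ => HC.isCompact_u2Box

theorem measurableSet_multiBox : MeasurableSet (multiBox n) :=
  MeasurableSet.univ_pi fun _ => HC.measurableSet_u2Box

theorem contDiff_aff : ContDiff ℂ 1 aff := by
  refine contDiff_pi.2 fun i => contDiff_pi.2 fun j => ?_
  rcases i with i | i
  · exact contDiff_pi.1 (contDiff_pi.1 contDiff_id i) j
  · exact contDiff_const

theorem continuous_config (r : Fin n → ℝ) :
    Continuous fun p : (External → HV) × (Fin n → Fin 4 → ℝ) => config r p.1 p.2 := by
  refine continuous_fst.prodMk (continuous_pi fun k => ?_)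
  exact contDiff_aff.continuous.comp ((HC.contDiff_u2Param (r k)).continuous.comp
    ((continuous_apply k).comp continuous_snd))

theorem continuous_density (r : Fin n → ℝ) : Continuous (density r) :=
  continuous_finsetProd _ fun k _ => (HC.continuous_dVDensity (r k)).comp (continuous_apply k)

theorem eventually_config_mem {d : BoxDiagram n} {r : Fin n → ℝ} {u : External → HV}
    {t : Fin n → Fin 4 → ℝ} (h : config r u t ∈ d.regular) :
    ∀ᶠ p : (External → HV) × (Fin n → Fin 4 → ℝ) in 𝓝 (u, t), config r p.1 p.2 ∈ d.regular :=
  (continuous_config r).continuousAt.preimage_mem_nhds (d.isOpen_regular.mem_nhds h)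

theorem isOpen_good (d : BoxDiagram n) (r : Fin n → ℝ) : IsOpen (d.good r) :=
  isOpen_iff_mem_nhds.2 fun _ hu => isCompact_multiBox.eventually_forall_of_forall_eventually
    fun t ht => eventually_config_mem (hu t ht)

/-- Differentiation under the integral sign for a kernel which is `C¹` near the compact set over
which one integrates. -/
theorem differentiableAt_integral_of_contDiffAt {E H α : Type*} [NormedAddCommGroup E]
    [NormedSpace ℂ E] [NormedAddCommGroup H] [NormedSpace ℂ H] [TopologicalSpace α]
    [SecondCountableTopology α] [MeasurableSpace α] [OpensMeasurableSpace α] {μ : Measure α}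
    [IsFiniteMeasureOnCompacts μ] {f : E × H → ℂ} {S : Set (E × H)} (hS : IsOpen S)
    (hf : ∀ w ∈ S, ContDiffAt ℂ 1 f w) {P : α → H} (hP : Continuous P) {ρ : α → ℂ}
    (hρ : Continuous ρ) {K : Set α} (hK : IsCompact K) (hKm : MeasurableSet K) {u : E}
    (hu : ∀ t ∈ K, (u, P t) ∈ S) :
    DifferentiableAt ℂ (fun v => ∫ t in K, f (v, P t) * ρ t ∂μ) u ∧
      ∀ v, fderiv ℂ (fun v => ∫ t in K, f (v, P t) * ρ t ∂μ) u v =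
        ∫ t in K, fderiv ℂ f (u, P t) (v, 0) * ρ t ∂μ := by
  let ι : E →L[ℂ] E × H := ContinuousLinearMap.inl ℂ _ _
  let F' : E → α → E →L[ℂ] ℂ := fun v t => ρ t • (fderiv ℂ f (v, P t)).comp ι
  have hcfg : Continuous fun p : E × α => (p.1, P p.2) := by fun_prop
  have hF'c : ∀ v t, (v, P t) ∈ S → ContinuousAt (fun p : E × α => F' p.1 p.2) (v, t) := by
    intro v t h
    have h1 : ContinuousAt (fderiv ℂ f) (v, P t) :=
      ((hf _ h).fderiv_right (m := 0) (by norm_num)).continuousAt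
    have h2 : ContinuousAt (fun p : E × α => fderiv ℂ f (p.1, P p.2)) (v, t) :=
      ContinuousAt.comp (f := fun p : E × α => (p.1, P p.2)) h1 hcfg.continuousAt
    exact (hρ.comp continuous_snd).continuousAt.smul (h2.clm_comp continuousAt_const)
  have hFc : ∀ v t, (v, P t) ∈ S → ContinuousAt (fun t => f (v, P t) * ρ t) t := by
    intro v t h
    refine ContinuousAt.mul ?_ hρ.continuousAt
    exact ContinuousAt.comp (f := fun t => (v, P t)) (hf _ h).continuousAt
      (hcfg.comp (Continuous.prodMk_right v)).continuousAt
  have hF'u : ContinuousOn (F' u) K := fun t ht =>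
    (ContinuousAt.comp (f := fun t => (u, t)) (hF'c u t (hu t ht))
      (Continuous.prodMk_right u).continuousAt).continuousWithinAt
  obtain ⟨C, hC⟩ := hK.exists_bound_of_continuousOn hF'u
  have hmem : ∀ t ∈ K, ∀ᶠ p : E × α in 𝓝 (u, t), (p.1, P p.2) ∈ S := fun t ht =>
    hcfg.continuousAt.preimage_mem_nhds (hS.mem_nhds (hu t ht))
  have hs : ∀ᶠ v in 𝓝 u, ∀ t ∈ K, (v, P t) ∈ S ∧ ‖F' v t‖ < C + 1 := by
    refine hK.eventually_forall_of_forall_eventually fun t ht => ?_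
    exact (hmem t ht).and ((hF'c u t (hu t ht)).norm.eventually_lt continuousAt_const
      (lt_of_le_of_lt (hC t ht) (lt_add_one C)))
  have hint : ∀ v, (∀ t ∈ K, (v, P t) ∈ S) → ContinuousOn (fun t => f (v, P t) * ρ t) K :=
    fun v hv t ht => (hFc v t (hv t ht)).continuousWithinAt
  have key := hasFDerivAt_integral_of_dominated_of_fderiv_le (𝕜 := ℂ)
    (μ := μ.restrict K) (F := fun v t => f (v, P t) * ρ t)
    (F' := F') (bound := fun _ => C + 1) hs
    (hs.mono fun v hv => (hint v fun t ht => (hv t ht).1).aestronglyMeasurable_of_isCompact hK hKm)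
    ((hint u hu).integrableOn_compact' hK hKm) (hF'u.aestronglyMeasurable_of_isCompact hK hKm)
    ((ae_restrict_mem hKm).mono fun t ht v hv => (hv t ht).2.le)
    (continuousOn_const.integrableOn_compact' hK hKm)
    ((ae_restrict_mem hKm).mono fun t ht v hv => by
      have h1 := ((hf _ (hv t ht).1).differentiableAt one_ne_zero).hasFDerivAt
      have h2 : HasFDerivAt (fun v => (v, P t)) ι v := hasFDerivAt_prodMk_left v (P t)
      exact (h1.comp v h2).mul_const (ρ t))
  refine ⟨key.differentiableAt, fun v => ?_⟩
  rw [key.fderiv, ContinuousLinearMap.integral_apply (hF'u.integrableOn_compact' hK hKm)]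
  refine integral_congr_ae (Filter.Eventually.of_forall fun t => ?_)
  simp [F', ι, mul_comm]

theorem differentiableAt_homIntegral (d : BoxDiagram n) (r : Fin n → ℝ) {u : External → HV}
    (hu : u ∈ d.good r) :
    DifferentiableAt ℂ (d.homIntegral r) u ∧ ∀ v : External → HV,
      fderiv ℂ (d.homIntegral r) u v =
        ∫ t in multiBox n, fderiv ℂ d.kernel (config r u t) (v, 0) * density r t := by
  have hP : Continuous fun (t : Fin n → Fin 4 → ℝ) (k : Fin n) => aff (HC.u2Param (r k) (t k)) :=
    continuous_snd.comp ((continuous_config r).comp (Continuous.prodMk_right u))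
  have hf : ∀ w ∈ d.regular, ContDiffAt ℂ 1 d.kernel w := fun _ hw => d.contDiffAt_kernel hw
  have hmem : ∀ t ∈ multiBox n, (u, fun k => aff (HC.u2Param (r k) (t k))) ∈ d.regular := hu
  exact differentiableAt_integral_of_contDiffAt (μ := volume) d.isOpen_regular hf hP
    (continuous_density r) isCompact_multiBox measurableSet_multiBox hmem

theorem continuousAt_fderiv_kernel (d : BoxDiagram n) (r : Fin n → ℝ) {u : External → HV}
    {t : Fin n → Fin 4 → ℝ} (h : config r u t ∈ d.regular)
    {V : (Fin n → Fin 4 → ℝ) → HW n} (hV : Continuous V) :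
    ContinuousAt (fun t => fderiv ℂ d.kernel (config r u t) (V t)) t := by
  have h1 : ContinuousAt (fderiv ℂ d.kernel) (config r u t) :=
    ((d.contDiffAt_kernel h).fderiv_right (m := 0) (by norm_num)).continuousAt
  exact (ContinuousAt.comp (f := config r u) h1
    ((continuous_config r).comp (Continuous.prodMk_right u)).continuousAt).clm_apply
    hV.continuousAt

theorem continuousAt_kernel_config (d : BoxDiagram n) (r : Fin n → ℝ) {u : External → HV}
    {t : Fin n → Fin 4 → ℝ} (h : config r u t ∈ d.regular) :
    ContinuousAt (fun t => d.kernel (config r u t)) t :=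
  ContinuousAt.comp (f := config r u) (d.contDiffAt_kernel h).continuousAt
    ((continuous_config r).comp (Continuous.prodMk_right u)).continuousAt

/-- The divergence of the integrand times the conformal vector field in the variable `T_k`. -/
noncomputable def divergence (d : BoxDiagram n) (r : Fin n → ℝ) (u : External → HV) (ξ : M4)
    (k : Fin n) (t : Fin n → Fin 4 → ℝ) : ℂ :=
  (fderiv ℂ d.kernel (config r u t)
      (0, Pi.single k (Matrix.fromRows (field ξ (HC.u2Param (r k) (t k))) 0)) +
    fieldDiv ξ (HC.u2Param (r k) (t k)) * d.kernel (config r u t)) * density r t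

theorem continuousOn_divergence (d : BoxDiagram n) (r : Fin n → ℝ) {u : External → HV}
    (hu : u ∈ d.good r) (ξ : M4) (k : Fin n) :
    ContinuousOn (d.divergence r u ξ k) (multiBox n) := by
  intro t ht
  have hz : Continuous fun t : Fin n → Fin 4 → ℝ => HC.u2Param (r k) (t k) :=
    (HC.contDiff_u2Param (r k)).continuous.comp (continuous_apply k)
  refine ContinuousAt.continuousWithinAt ?_
  refine ContinuousAt.mul (ContinuousAt.add ?_ (ContinuousAt.mul ?_
    (d.continuousAt_kernel_config r (hu t ht)))) (continuous_density r).continuousAt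
  · refine d.continuousAt_fderiv_kernel r (hu t ht) (continuous_const.prodMk ?_)
    refine (continuous_single k).comp ?_
    have hfield : Continuous fun t : Fin n → Fin 4 → ℝ => field ξ (HC.u2Param (r k) (t k)) := by
      simp only [field]
      fun_prop
    refine continuous_pi fun i => continuous_pi fun j => ?_
    rcases i with i | i
    · exact hfield.matrix_elem i j
    · exact continuous_const
  · simp only [fieldDiv]
    refine Continuous.continuousAt ?_
    fun_prop

/-- Stokes' theorem in the variable `T_k`. -/
theorem integral_divergence (d : BoxDiagram n) (r : Fin n → ℝ) {u : External → HV}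
    (hu : u ∈ d.good r) (ξ : M4) (k : Fin n) :
    ∫ t in multiBox n, d.divergence r u ξ k t = 0 := by
  refine HC.integral_pi_u2Box_eq_zero k _ fun t ht => ?_
  let φ : HC → HW n := fun Z =>
    (u, Function.update (fun j => aff (HC.u2Param (r j) (t j))) k (aff Z))
  have hup : ∀ s, config r u (Function.update t k s) = φ (HC.u2Param (r k) s) := by
    intro s
    refine Prod.ext rfl ?_
    funext j
    by_cases hj : j = k
    · subst hj
      simp [config, φ]
    · simp [config, φ, hj]
  have hmem : ∀ s ∈ HC.u2Box, Function.update t k s ∈ multiBox n := by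
    intro s hs j _
    by_cases hj : j = k
    · subst hj
      simpa using hs
    · simpa [hj] using ht j trivial
  have hreg : ∀ s ∈ HC.u2Box, φ (HC.u2Param (r k) s) ∈ d.regular := fun s hs =>
    hup s ▸ hu _ (hmem s hs)
  have hφc : ContDiff ℂ 1 φ := by
    refine contDiff_const.prodMk (contDiff_pi.2 fun j => ?_)
    by_cases hj : j = k
    · subst hj
      simpa using contDiff_aff
    · simpa [hj] using contDiff_const
  have hg : ∀ s ∈ HC.u2Box, ContDiffAt ℂ 1 (fun Z => d.kernel (φ Z)) (HC.u2Param (r k) s) :=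
    fun s hs => ContDiffAt.comp (f := φ) _ (d.contDiffAt_kernel (hreg s hs)) hφc.contDiffAt
  have hfg : ∀ s ∈ HC.u2Box, ∀ V, fderiv ℂ (fun Z => d.kernel (φ Z)) (HC.u2Param (r k) s) V =
      fderiv ℂ d.kernel (φ (HC.u2Param (r k) s)) (0, Pi.single k (Matrix.fromRows V 0)) := by
    intro s hs V
    have h1 := ((hg s hs).differentiableAt one_ne_zero).lineDeriv_eq_fderiv (v := V)
    have h2 := ((d.contDiffAt_kernel (hreg s hs)).differentiableAt
      one_ne_zero).lineDeriv_eq_fderiv (v := (0, Pi.single k (Matrix.fromRows V 0)))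
    have hline : ∀ (Z : HC) (τ : ℂ), φ (Z + τ • V) =
        φ Z + τ • ((0, Pi.single k (Matrix.fromRows V 0)) : HW n) := by
      intro Z τ
      refine Prod.ext ?_ ?_
      · simp [φ]
      · funext j
        by_cases hj : j = k
        · subst hj
          ext (a | a) b <;> simp [φ, aff]
        · simp [φ, hj]
    refine h1.symm.trans (Eq.trans ?_ h2)
    simp only [lineDeriv, hline]
  have hρ : ∀ s, density r (Function.update t k s) =
      HC.dVDensity (r k) s * ∏ j ∈ Finset.univ.erase k, HC.dVDensity (r j) (t j) := by
    intro s
    have h1 : ∏ j ∈ Finset.univ.erase k, HC.dVDensity (r j) (Function.update t k s j) =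
        ∏ j ∈ Finset.univ.erase k, HC.dVDensity (r j) (t j) :=
      Finset.prod_congr rfl fun j hj => by
        rw [Function.update_of_ne (Finset.ne_of_mem_erase hj)]
    rw [density, ← Finset.mul_prod_erase _ _ (Finset.mem_univ k), h1, Function.update_self]
  have hpt : ∀ s ∈ HC.u2Box, d.divergence r u ξ k (Function.update t k s) =
      (fderiv ℂ (fun Z => d.kernel (φ Z)) (HC.u2Param (r k) s) (field ξ (HC.u2Param (r k) s)) +
        fieldDiv ξ (HC.u2Param (r k) s) * d.kernel (φ (HC.u2Param (r k) s))) *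
      HC.dVDensity (r k) s * ∏ j ∈ Finset.univ.erase k, HC.dVDensity (r j) (t j) := by
    intro s hs
    rw [hfg s hs, divergence, hρ, hup, Function.update_self, mul_assoc]
  rw [setIntegral_congr_fun HC.measurableSet_u2Box hpt, integral_mul_const,
    integral_field ξ (r k) _ hg, zero_mul]

/-- The infinitesimal conformal covariance of the box integral. -/
theorem fderiv_homIntegral (d : BoxDiagram n) (r : Fin n → ℝ) {u : External → HV}
    (hu : u ∈ d.good r) (ξ : M4) :
    fderiv ℂ (d.homIntegral r) u (fun e => ξ * u e) = -(2 * ξ.trace) * d.homIntegral r u := by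
  rw [(d.differentiableAt_homIntegral r hu).2]
  have hint : ∀ k, IntegrableOn (d.divergence r u ξ k) (multiBox n) := fun k =>
    (d.continuousOn_divergence r hu ξ k).integrableOn_compact isCompact_multiBox
  have hmain : ∀ t ∈ multiBox n, fderiv ℂ d.kernel (config r u t) (fun e => ξ * u e, 0) *
      density r t = -(2 * ξ.trace) * (d.kernel (config r u t) * density r t) -
        ∑ k, d.divergence r u ξ k t := by
    intro t ht
    have h : fderiv ℂ d.kernel (config r u t) (fun e => ξ * u e, 0) = _ :=
      d.fderiv_kernel_external (T := fun k => HC.u2Param (r k) (t k)) (hu t ht) ξ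
    rw [h, sub_mul, Finset.sum_mul, mul_assoc]
    rfl
  have hk : IntegrableOn (fun t => d.kernel (config r u t) * density r t) (multiBox n) :=
    ContinuousOn.integrableOn_compact isCompact_multiBox fun t ht =>
      ((d.continuousAt_kernel_config r (hu t ht)).mul
        (continuous_density r).continuousAt).continuousWithinAt
  rw [setIntegral_congr_fun measurableSet_multiBox hmain,
    integral_sub (hk.const_mul _) (integrable_finsetSum _ fun k _ => hint k), integral_const_mul,
    integral_finsetSum _ fun k _ => hint k]
  simp [d.integral_divergence r hu, homIntegral]

end BoxDiagram

/-! ### The indefinite hermitian form -/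

/-- The squared hermitian norm of a vector. -/
noncomputable def nsq {ι : Type*} [Fintype ι] (x : ι → ℂ) : ℝ := ∑ i, ‖x i‖ ^ 2

theorem nsq_nonneg {ι : Type*} [Fintype ι] (x : ι → ℂ) : 0 ≤ nsq x :=
  Finset.sum_nonneg fun _ _ => sq_nonneg _

theorem nsq_pos {ι : Type*} [Fintype ι] {x : ι → ℂ} (hx : x ≠ 0) : 0 < nsq x := by
  obtain ⟨i, hi⟩ := Function.ne_iff.1 hx
  exact Finset.sum_pos' (fun _ _ => sq_nonneg _) ⟨i, Finset.mem_univ i, by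
    have := norm_pos_iff.2 hi
    positivity⟩

theorem ofReal_nsq {ι : Type*} [Fintype ι] (x : ι → ℂ) : (nsq x : ℂ) = star x ⬝ᵥ x := by
  simp [nsq, dotProduct, Complex.conj_mul']

theorem norm_star_dotProduct_sq_le {ι : Type*} [Fintype ι] (x y : ι → ℂ) :
    ‖star x ⬝ᵥ y‖ ^ 2 ≤ nsq x * nsq y := by
  have h1 : ‖star x ⬝ᵥ y‖ ≤ ∑ i, ‖x i‖ * ‖y i‖ := by
    refine (norm_sum_le _ _).trans (le_of_eq ?_)
    simp
  exact (pow_le_pow_left₀ (norm_nonneg _) h1 2).trans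
    (Finset.sum_mul_sq_le_sq_mul_sq _ _ _)

theorem star_mulVec_dotProduct (Z : HC) (x y : Fin 2 → ℂ) :
    star (Z *ᵥ x) ⬝ᵥ y = star x ⬝ᵥ (Zᴴ *ᵥ y) := by
  rw [Matrix.star_mulVec, Matrix.dotProduct_mulVec]

namespace HV

/-- The hermitian form `|P|² - R² |Q|²` on `ℂ² ⊕ ℂ²`. -/
noncomputable def hform (R : ℝ) (y : Fin 2 ⊕ Fin 2 → ℂ) : ℝ :=
  nsq (fun i => y (Sum.inl i)) - R ^ 2 * nsq (fun i => y (Sum.inr i))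

/-- The plane spanned by the columns of `u` is positive for `hform R`. In affine coordinates this
is the domain `𝔻⁻_R`. -/
def Above (R : ℝ) (u : HV) : Prop := ∀ x : Fin 2 → ℂ, x ≠ 0 → 0 < hform R (u *ᵥ x)

/-- The plane spanned by the columns of `u` is negative for `hform R`. In affine coordinates this
is the domain `𝔻⁺_R`. -/
def Below (R : ℝ) (u : HV) : Prop := ∀ x : Fin 2 → ℂ, x ≠ 0 → hform R (u *ᵥ x) < 0

theorem hform_fromRows (R : ℝ) (P Q : HC) (x : Fin 2 → ℂ) :
    hform R (Matrix.fromRows P Q *ᵥ x) = nsq (P *ᵥ x) - R ^ 2 * nsq (Q *ᵥ x) := by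
  rw [Matrix.fromRows_mulVec]
  rfl

theorem hform_aff (R : ℝ) (Z : HC) (x : Fin 2 → ℂ) :
    hform R (aff Z *ᵥ x) = nsq (Z *ᵥ x) - R ^ 2 * nsq x := by
  rw [aff, hform_fromRows, Matrix.one_mulVec]

/-- Along a real line the form is a quadratic polynomial with leading coefficient `hform R y`. -/
theorem hform_add_smul (R s : ℝ) (x y : Fin 2 ⊕ Fin 2 → ℂ) :
    hform R (x + (s : ℂ) • y) =
      (1 - s) * hform R x + s * hform R (x + y) - s * (1 - s) * hform R y := by
  have h : ∀ a b : ℂ, ‖a + s * b‖ ^ 2 =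
      (1 - s) * ‖a‖ ^ 2 + s * ‖a + b‖ ^ 2 - s * (1 - s) * ‖b‖ ^ 2 := by
    intro a b
    simp only [← Complex.normSq_eq_norm_sq, Complex.normSq_apply, Complex.add_re, Complex.add_im,
      Complex.re_ofReal_mul, Complex.im_ofReal_mul]
    ring
  simp only [hform, nsq, Pi.add_apply, Pi.smul_apply, smul_eq_mul, h, Fin.sum_univ_two]
  ring

theorem hform_smul (R : ℝ) (c : ℂ) (y : Fin 2 ⊕ Fin 2 → ℂ) :
    hform R (c • y) = ‖c‖ ^ 2 * hform R y := by
  simp only [hform, nsq, Pi.smul_apply, smul_eq_mul, norm_mul, mul_pow, Fin.sum_univ_two]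
  ring

theorem continuous_hform (R : ℝ) : Continuous (hform R) := by
  unfold hform nsq
  fun_prop

/-- A strict sign condition on a plane is open, by compactness of the unit sphere. -/
theorem isOpen_forall_pos (R c : ℝ) :
    IsOpen {u : HV | ∀ x : Fin 2 → ℂ, x ≠ 0 → 0 < c * hform R (u *ᵥ x)} := by
  refine isOpen_iff_mem_nhds.2 fun u hu => ?_
  have hc : Continuous fun p : HV × (Fin 2 → ℂ) => c * hform R (p.1 *ᵥ p.2) := by
    have := continuous_hform R
    fun_prop
  have h1 : ∀ᶠ v : HV in 𝓝 u, ∀ x ∈ Metric.sphere (0 : Fin 2 → ℂ) 1,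
      0 < c * hform R (v *ᵥ x) := by
    refine (isCompact_sphere _ _).eventually_forall_of_forall_eventually fun x hx => ?_
    exact continuousAt_const.eventually_lt hc.continuousAt
      (hu x (ne_zero_of_mem_unit_sphere ⟨x, hx⟩))
  filter_upwards [h1] with v hv x hx
  have hn : 0 < ‖x‖ := norm_pos_iff.2 hx
  have h2 := hv (((‖x‖⁻¹ : ℝ) : ℂ) • x) (by simp [norm_smul, hn.ne'])
  rw [Matrix.mulVec_smul, hform_smul] at h2
  by_contra h3
  have : 0 ≤ ‖((‖x‖⁻¹ : ℝ) : ℂ)‖ ^ 2 := sq_nonneg _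
  nlinarith [mul_nonneg this (neg_nonneg.2 (not_lt.1 h3))]

theorem isOpen_above (R : ℝ) : IsOpen {u | Above R u} := by
  have h := isOpen_forall_pos R 1
  simp only [one_mul] at h
  exact h

theorem isOpen_below (R : ℝ) : IsOpen {u | Below R u} := by
  have h := isOpen_forall_pos R (-1)
  simp only [neg_mul, one_mul, neg_pos] at h
  exact h

theorem Above.mul_right {R : ℝ} {u : HV} (h : Above R u) {D : HC} (hD : D.det ≠ 0) :
    Above R (u * D) := by
  intro x hx
  rw [← Matrix.mulVec_mulVec]
  exact h _ fun h0 => hD (Matrix.exists_mulVec_eq_zero_iff.1 ⟨x, hx, h0⟩)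

theorem Below.mul_right {R : ℝ} {u : HV} (h : Below R u) {D : HC} (hD : D.det ≠ 0) :
    Below R (u * D) := by
  intro x hx
  rw [← Matrix.mulVec_mulVec]
  exact h _ fun h0 => hD (Matrix.exists_mulVec_eq_zero_iff.1 ⟨x, hx, h0⟩)

theorem mem_DMinus_iff {R : ℝ} {Z : HC} : Z ∈ HC.DMinus R ↔ Above R (aff Zᴴ) := by
  have hq : ∀ x : Fin 2 → ℂ, star x ⬝ᵥ ((Z * Zᴴ - ((R ^ 2 : ℝ) : ℂ) • (1 : HC)) *ᵥ x) =
      ((nsq (Zᴴ *ᵥ x) - R ^ 2 * nsq x : ℝ) : ℂ) := by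
    intro x
    push_cast
    rw [ofReal_nsq, ofReal_nsq, star_mulVec_dotProduct, Matrix.sub_mulVec, dotProduct_sub,
      Matrix.conjTranspose_conjTranspose, Matrix.mulVec_mulVec, Matrix.smul_mulVec,
      Matrix.one_mulVec, dotProduct_smul, smul_eq_mul]
  have hh : (Z * Zᴴ - ((R ^ 2 : ℝ) : ℂ) • (1 : HC)).IsHermitian := by
    simp [Matrix.IsHermitian, Matrix.conjTranspose_sub, Matrix.conjTranspose_smul]
  rw [HC.DMinus, Set.mem_ofPred_eq, Matrix.posDef_iff_dotProduct_mulVec]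
  simp only [hq, Complex.zero_lt_real, Above, hform_aff, hh, true_and]

theorem mem_DPlus_iff {R : ℝ} {Z : HC} : Z ∈ HC.DPlus R ↔ Below R (aff Zᴴ) := by
  have hq : ∀ x : Fin 2 → ℂ, star x ⬝ᵥ ((((R ^ 2 : ℝ) : ℂ) • (1 : HC) - Z * Zᴴ) *ᵥ x) =
      ((R ^ 2 * nsq x - nsq (Zᴴ *ᵥ x) : ℝ) : ℂ) := by
    intro x
    push_cast
    rw [ofReal_nsq, ofReal_nsq, star_mulVec_dotProduct, Matrix.sub_mulVec, dotProduct_sub,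
      Matrix.conjTranspose_conjTranspose, Matrix.mulVec_mulVec, Matrix.smul_mulVec,
      Matrix.one_mulVec, dotProduct_smul, smul_eq_mul]
  have hh : (((R ^ 2 : ℝ) : ℂ) • (1 : HC) - Z * Zᴴ).IsHermitian := by
    simp [Matrix.IsHermitian, Matrix.conjTranspose_sub, Matrix.conjTranspose_smul]
  rw [HC.DPlus, Set.mem_ofPred_eq, Matrix.posDef_iff_dotProduct_mulVec]
  simp only [hq, Complex.zero_lt_real, Below, hform_aff, hh, true_and, sub_pos, sub_neg]

/-- `Z Z^* > R²` implies `Z^* Z > R²`. -/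
theorem Above.conjTranspose {R : ℝ} {Z : HC} (h : Above R (aff Zᴴ)) : Above R (aff Z) := by
  intro x hx
  have hdet : Zᴴ.det ≠ 0 := fun h0 => by
    obtain ⟨y, hy, hy0⟩ := Matrix.exists_mulVec_eq_zero_iff.2 h0
    have := h y hy
    rw [hform_aff, hy0] at this
    have h2 : nsq (0 : Fin 2 → ℂ) = 0 := by simp [nsq]
    nlinarith [mul_nonneg (sq_nonneg R) (nsq_nonneg y)]
  have hxy : Zᴴ *ᵥ (Zᴴ⁻¹ *ᵥ x) = x := by
    rw [Matrix.mulVec_mulVec, Matrix.mul_nonsing_inv _ (isUnit_iff_ne_zero.2 hdet),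
      Matrix.one_mulVec]
  set y := Zᴴ⁻¹ *ᵥ x
  have hy : y ≠ 0 := fun h0 => hx (by rw [← hxy, h0, Matrix.mulVec_zero])
  have h1 := h y hy
  rw [hform_aff, hxy] at h1
  rw [hform_aff]
  have h2 : ‖star x ⬝ᵥ x‖ ^ 2 ≤ nsq y * nsq (Z *ᵥ x) := by
    have h3 : star x ⬝ᵥ x = star y ⬝ᵥ (Z *ᵥ x) := by
      conv_lhs => rw [← hxy]
      rw [star_mulVec_dotProduct, Matrix.conjTranspose_conjTranspose, hxy]
    rw [h3]
    exact norm_star_dotProduct_sq_le _ _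
  rw [← ofReal_nsq, Complex.norm_real, Real.norm_of_nonneg (nsq_nonneg x)] at h2
  have hx' := nsq_pos hx
  have hy' := nsq_pos hy
  have hZ : 0 < nsq (Z *ᵥ x) := by
    by_contra h3
    have := nsq_nonneg (Z *ᵥ x)
    have h4 : nsq (Z *ᵥ x) = 0 := le_antisymm (not_lt.1 h3) this
    rw [h4] at h2
    nlinarith
  have h5 : R ^ 2 * nsq x * nsq x < nsq (Z *ᵥ x) * nsq x := by
    nlinarith [mul_le_mul_of_nonneg_left h2 (sq_nonneg R), mul_pos (sub_pos.2 (sub_pos.1 h1)) hZ]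
  exact sub_pos.2 (lt_of_mul_lt_mul_right h5 hx'.le)

/-- `Z Z^* < R²` implies `Z^* Z < R²`. -/
theorem Below.conjTranspose {R : ℝ} {Z : HC} (hR : 0 < R) (h : Below R (aff Zᴴ)) :
    Below R (aff Z) := by
  intro x hx
  rw [hform_aff]
  have hx' := nsq_pos hx
  by_cases hy : Z *ᵥ x = 0
  · have h2 : nsq (0 : Fin 2 → ℂ) = 0 := by simp [nsq]
    rw [hy, h2]
    have : 0 < R ^ 2 * nsq x := by positivity
    linarith
  · have h1 := h _ hy
    rw [hform_aff] at h1
    have h2 : ‖star (Z *ᵥ x) ⬝ᵥ (Z *ᵥ x)‖ ^ 2 ≤ nsq x * nsq (Zᴴ *ᵥ (Z *ᵥ x)) := by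
      rw [star_mulVec_dotProduct]
      exact norm_star_dotProduct_sq_le _ _
    rw [← ofReal_nsq, Complex.norm_real, Real.norm_of_nonneg (nsq_nonneg _)] at h2
    have hy' := nsq_pos hy
    have h3 : nsq (Z *ᵥ x) * nsq (Z *ᵥ x) < R ^ 2 * nsq x * nsq (Z *ᵥ x) := by
      nlinarith [mul_pos hx' (sub_pos.2 (sub_neg.1 h1))]
    exact sub_neg.2 (lt_of_mul_lt_mul_right h3 hy'.le)

/-- Points of `U(2)_R` are isotropic for `hform R`. -/
theorem nsq_u2Param_mulVec (R : ℝ) {t : Fin 4 → ℝ} (ht : t ∈ HC.u2Box) (x : Fin 2 → ℂ) :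
    nsq (HC.u2Param R t *ᵥ x) = R ^ 2 * nsq x := by
  have hU : HC.u2Param R t ∈ HC.U2 R := HC.u2Param_image R ▸ Set.mem_image_of_mem _ ht
  obtain ⟨T, hT, hz⟩ := hU
  have h : ((nsq (HC.u2Param R t *ᵥ x) : ℝ) : ℂ) = ((R ^ 2 * nsq x : ℝ) : ℂ) := by
    have h1 : Tᴴ * T = 1 := Matrix.mem_unitaryGroup_iff'.1 hT
    push_cast
    rw [ofReal_nsq, ofReal_nsq, hz, star_mulVec_dotProduct, Matrix.mulVec_mulVec,
      Matrix.conjTranspose_smul, smul_mul_smul_comm, h1, Matrix.smul_mulVec, Matrix.one_mulVec,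
      dotProduct_smul, smul_eq_mul]
    simp [pow_two]
  exact_mod_cast h

theorem bracket_aff_u2Param_ne_zero {R : ℝ} {t : Fin 4 → ℝ} (ht : t ∈ HC.u2Box) {u : HV}
    (hu : Above R u ∨ Below R u) : bracket u (aff (HC.u2Param R t)) ≠ 0 := by
  intro h0
  obtain ⟨x, hx, h⟩ := exists_mulVec_of_bracket_aff_eq_zero h0
  have h1 : hform R (u *ᵥ x) = 0 := by
    conv_lhs => rw [← Matrix.fromRows_toRows u, hform_fromRows, h, nsq_u2Param_mulVec R ht]
    exact sub_self _
  rcases hu with hu | hu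
  · exact (hu x hx).ne' h1
  · exact (hu x hx).ne h1

end HV

/-! ### Covariance and analytic continuation -/

namespace BoxDiagram

open HV

variable {n : ℕ}

/-- Nondegeneracy on the cycle: the poles are avoided when the external points lie on the side of
each adjacent cycle prescribed by the ordering. -/
theorem mem_good (d : BoxDiagram n) {r : Fin n → ℝ} (hr : d.Admissible r) {u : External → HV}
    (hA : ∀ k e, (Vertex.T k, Vertex.ext e) ∈ d.solid → Above (r k) (u e))
    (hB : ∀ k e, (Vertex.ext e, Vertex.T k) ∈ d.solid → Below (r k) (u e)) : u ∈ d.good r := by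
  intro t ht p hp
  have ht' : ∀ k, t k ∈ HC.u2Box := fun k => ht k trivial
  rcases d.solid_cases hp with ⟨i, j, rfl⟩ | ⟨k, rfl | rfl⟩ | ⟨k, rfl | rfl⟩
  · refine bracket_aff_u2Param_ne_zero (ht' j) (Or.inr fun x hx => ?_)
    have hlt : r i < r j := hr.2 i j (Relation.TransGen.single hp)
    have hi := hr.1 i
    have h1 : r i ^ 2 < r j ^ 2 := by nlinarith
    change hform (r j) (aff (HC.u2Param (r i) (t i)) *ᵥ x) < 0
    rw [hform_aff, nsq_u2Param_mulVec _ (ht' i)]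
    nlinarith [nsq_pos hx]
  · rw [bracket_comm]
    exact bracket_aff_u2Param_ne_zero (ht' k) (Or.inl (hA k _ hp))
  · rw [bracket_comm]
    exact bracket_aff_u2Param_ne_zero (ht' k) (Or.inl (hA k _ hp))
  · exact bracket_aff_u2Param_ne_zero (ht' k) (Or.inr (hB k _ hp))
  · exact bracket_aff_u2Param_ne_zero (ht' k) (Or.inr (hB k _ hp))

theorem above_aff_of_mem_domain (d : BoxDiagram n) {r : Fin n → ℝ}
    {X : External → HC} (hX : X ∈ d.domain r) {k : Fin n} {e : External}
    (h : (Vertex.T k, Vertex.ext e) ∈ d.solid) : Above (r k) (aff (X e)) := by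
  have hp : d.Prec (.T k) (.ext e) := Relation.TransGen.single h
  rcases d.eq_Z_of_mem_solid h with rfl | rfl
  · exact (mem_DMinus_iff.1 ((hX k).1 hp)).conjTranspose
  · exact (mem_DMinus_iff.1 ((hX k).2.1 hp)).conjTranspose

theorem below_aff_of_mem_domain (d : BoxDiagram n) {r : Fin n → ℝ} (hr : d.Admissible r)
    {X : External → HC} (hX : X ∈ d.domain r) {k : Fin n} {e : External}
    (h : (Vertex.ext e, Vertex.T k) ∈ d.solid) : Below (r k) (aff (X e)) := by
  have hp : d.Prec (.ext e) (.T k) := Relation.TransGen.single h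
  rcases d.eq_W_of_mem_solid h with rfl | rfl
  · exact (mem_DPlus_iff.1 ((hX k).2.2.1 hp)).conjTranspose (hr.1 k)
  · exact (mem_DPlus_iff.1 ((hX k).2.2.2 hp)).conjTranspose (hr.1 k)

/-- Conformal covariance along the segment from the identity to `A`, as long as this segment keeps
the external points away from the poles. -/
theorem homIntegral_mul (d : BoxDiagram n) (r : Fin n → ℝ) (u : External → HV) (A : M4)
    (hdet : ∀ t ∈ Set.Icc (0 : ℝ) 1, (1 + (t : ℂ) • (A - 1)).det ≠ 0)
    (hgood : ∀ t ∈ Set.Icc (0 : ℝ) 1, (fun e => (1 + (t : ℂ) • (A - 1)) * u e) ∈ d.good r) :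
    d.homIntegral r (fun e => A * u e) = (A.det ^ 2)⁻¹ * d.homIntegral r u := by
  set B : M4 := A - 1 with hB
  let Φ : ℂ → ℂ := fun τ => (1 + τ • B).det ^ 2 * d.homIntegral r (fun e => (1 + τ • B) * u e)
  have hΦ : ∀ t ∈ Set.Icc (0 : ℝ) 1, HasDerivAt Φ 0 (t : ℂ) := by
    intro t ht
    set At : M4 := 1 + (t : ℂ) • B with hAt
    set v : External → HV := fun e => At * u e with hv
    set ξ : M4 := B * At⁻¹ with hξ
    have hξA : ξ * At = B := by
      rw [hξ, mul_assoc, Matrix.nonsing_inv_mul _ (isUnit_iff_ne_zero.2 (hdet t ht)), mul_one]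
    -- After the change of parameter `τ = t + σ` the matrix `1 + τ B` factors as `(1 + σ ξ) At`.
    have hfac : ∀ σ : ℂ, 1 + ((t : ℂ) + σ) • B = (1 + σ • ξ) * At := by
      intro σ
      rw [add_mul, one_mul, smul_mul_assoc, hξA, hAt, add_smul]
      abel
    have hL := (d.differentiableAt_homIntegral r (hgood t ht)).1
    have hLd : HasDerivAt (fun σ : ℂ => d.homIntegral r (v + σ • fun e => ξ * v e))
        (-(2 * ξ.trace) * d.homIntegral r v) 0 := by
      rw [← d.fderiv_homIntegral r (hgood t ht) ξ]
      exact hL.hasFDerivAt.hasLineDerivAt _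
    have hdd := hasDerivAt_det_one_add_smul ξ
    have h0 : HasDerivAt (fun σ : ℂ => Φ (t + σ)) 0 0 := by
      have h1 : (fun σ : ℂ => Φ (t + σ)) = fun σ : ℂ => ((1 + σ • ξ).det ^ 2 * At.det ^ 2) *
          d.homIntegral r (v + σ • fun e => ξ * v e) := by
        funext σ
        have h2 : (fun e => (1 + σ • ξ) * At * u e) = v + σ • fun e => ξ * v e := by
          funext e
          simp [hv, Matrix.add_mul, Matrix.mul_assoc]
        simp only [Φ, hfac, Matrix.det_mul, mul_pow, h2]
      rw [h1]
      refine (((hdd.pow 2).mul_const (At.det ^ 2)).mul hLd).congr_deriv ?_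
      simp
      ring
    have h3 := HasDerivAt.comp_sub_const (f := fun σ : ℂ => Φ (t + σ)) (t : ℂ) (t : ℂ)
      (by rwa [sub_self])
    simpa using h3
  have hconst := constant_of_has_deriv_right_zero (f := fun t : ℝ => Φ t) (a := 0) (b := 1)
    (fun t ht => (hΦ t ht).comp_ofReal.continuousAt.continuousWithinAt)
    (fun t ht => (hΦ t ⟨ht.1, ht.2.le⟩).comp_ofReal.hasDerivWithinAt) 1 (by simp)
  have hA : A.det ≠ 0 := by
    have := hdet 1 (by simp)
    simpa [hB] using this
  simp only [Φ, hB, Complex.ofReal_one, Complex.ofReal_zero, one_smul, zero_smul, add_zero,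
    add_sub_cancel, Matrix.det_one, one_pow, one_mul, Matrix.one_mul] at hconst
  rw [← hconst, inv_mul_cancel_left₀ (pow_ne_zero 2 hA)]

/-- The path `s ↦ (Z₁ / s, Z₂ / s; s W₁, s W₂)` in homogeneous coordinates, in which it extends to
`s = 0` with value `(∞, ∞; 0, 0)` if the `Zᵢ` are invertible. -/
def path (X : External → HC) (s : ℂ) : External → HV
  | .Z₁ => Matrix.fromRows (X .Z₁) (s • (1 : HC))
  | .Z₂ => Matrix.fromRows (X .Z₂) (s • (1 : HC))
  | .W₁ => Matrix.fromRows (s • X .W₁) 1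
  | .W₂ => Matrix.fromRows (s • X .W₂) 1

theorem path_one (X : External → HC) : path X 1 = fun e => aff (X e) := by
  funext e
  cases e <;> simp [path, aff]

theorem differentiable_path (X : External → HC) : Differentiable ℂ (path X) := by
  refine differentiable_pi.2 fun e => differentiable_pi.2 fun i => differentiable_pi.2 fun j => ?_
  cases e <;> rcases i with i | i <;> simp [path]

/-- Homogeneous coordinates of the point at infinity. -/
def infty : HV := Matrix.fromRows (1 : HC) (0 : HC)

/-- Matrices which keep `∞` and `0` on their sides of all the cycles. -/
def Tame (r : Fin n → ℝ) (A : M4) : Prop :=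
  ∀ k, Above (r k) (A * infty) ∧ Below (r k) (A * aff 0)

theorem tame_one {r : Fin n → ℝ} (hr : ∀ k, 0 < r k) : Tame r (1 : M4) := by
  intro k
  have h2 : nsq (0 : Fin 2 → ℂ) = 0 := by simp [nsq]
  refine ⟨fun x hx => ?_, fun x hx => ?_⟩
  · rw [Matrix.one_mul, infty, hform_fromRows, Matrix.one_mulVec, Matrix.zero_mulVec, h2]
    simpa using nsq_pos hx
  · rw [Matrix.one_mul, hform_aff, Matrix.zero_mulVec, h2]
    have := mul_pos (pow_pos (hr k) 2) (nsq_pos hx)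
    linarith

theorem isOpen_tame (r : Fin n → ℝ) : IsOpen {A : M4 | Tame r A} := by
  have h : {A : M4 | Tame r A} = ⋂ k, ((fun A : M4 => A * infty) ⁻¹'
      {u | Above (r k) u} ∩ (fun A : M4 => A * aff 0) ⁻¹' {u | Below (r k) u}) := by
    ext A
    simp [Tame]
  rw [h]
  refine isOpen_iInter_of_finite fun k => ?_
  exact ((isOpen_above (r k)).preimage (by fun_prop)).inter
    ((isOpen_below (r k)).preimage (by fun_prop))

/-- The sides of the cycle are star-shaped about `∞`, since the form is concave in the direction
of the second coordinate plane. -/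
theorem Tame.above_path {r : Fin n → ℝ} {A : M4} (hA : Tame r A) (k : Fin n) {Z : HC}
    (hZ : ∀ x : Fin 2 → ℂ, x ≠ 0 → Z *ᵥ x ≠ 0) {s : ℝ} (hs : s ∈ Set.Icc (0 : ℝ) 1)
    (h : s = 0 ∨ Above (r k) (A * aff Z)) :
    Above (r k) (A * Matrix.fromRows Z ((s : ℂ) • (1 : HC))) := by
  intro x hx
  have hy : ∀ c : ℂ, A * Matrix.fromRows Z (c • (1 : HC)) =
      A * infty * Z + c • (A * aff 0) := by
    intro c
    rw [Matrix.mul_assoc, ← Matrix.mul_smul, ← Matrix.mul_add]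
    congr 1
    rw [infty, Matrix.fromRows_mul]
    ext (i | i) j <;> simp [aff]
  have h0 : 0 < hform (r k) ((A * infty) *ᵥ (Z *ᵥ x)) := (hA k).1 _ (hZ x hx)
  have h1 := (hA k).2 x hx
  rw [hy, Matrix.add_mulVec, Matrix.smul_mulVec, ← Matrix.mulVec_mulVec x (A * infty) Z,
    hform_add_smul]
  rcases h with rfl | h
  · simpa using h0
  · have h2 := h x hx
    have haff : aff Z = Matrix.fromRows Z ((1 : ℂ) • (1 : HC)) := by rw [one_smul]; rfl
    rw [haff, hy, one_smul, Matrix.add_mulVec, ← Matrix.mulVec_mulVec x (A * infty) Z] at h2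
    obtain ⟨hs0, hs1⟩ := hs
    rcases eq_or_lt_of_le hs0 with rfl | hs0
    · simpa using h0
    · nlinarith [mul_nonneg (sub_nonneg.2 hs1) h0.le, mul_pos hs0 h2,
        mul_nonneg (mul_nonneg hs0.le (sub_nonneg.2 hs1)) (neg_nonneg.2 h1.le)]

/-- The sides of the cycle are star-shaped about `0`, since the form is convex in the direction
of the first coordinate plane. -/
theorem Tame.below_path {r : Fin n → ℝ} {A : M4} (hA : Tame r A) (k : Fin n) {W : HC} {s : ℝ}
    (hs : s ∈ Set.Icc (0 : ℝ) 1) (h : s = 0 ∨ Below (r k) (A * aff W)) :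
    Below (r k) (A * Matrix.fromRows ((s : ℂ) • W) (1 : HC)) := by
  intro x hx
  have hy : ∀ c : ℂ, A * Matrix.fromRows (c • W) (1 : HC) =
      A * aff 0 + c • (A * infty * W) := by
    intro c
    rw [Matrix.mul_assoc, ← Matrix.mul_smul, ← Matrix.mul_add]
    congr 1
    rw [infty, Matrix.fromRows_mul]
    ext (i | i) j <;> simp [aff]
  have h0 := (hA k).2 x hx
  have h1 : 0 ≤ hform (r k) ((A * infty) *ᵥ (W *ᵥ x)) := by
    by_cases hW : W *ᵥ x = 0
    · rw [hW, Matrix.mulVec_zero]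
      simp [hform, nsq]
    · exact ((hA k).1 _ hW).le
  rw [hy, Matrix.add_mulVec, Matrix.smul_mulVec, ← Matrix.mulVec_mulVec x (A * infty) W,
    hform_add_smul]
  rcases h with rfl | h
  · simpa using h0
  · have h2 := h x hx
    have haff : aff W = Matrix.fromRows ((1 : ℂ) • W) (1 : HC) := by rw [one_smul]; rfl
    rw [haff, hy, one_smul, Matrix.add_mulVec, ← Matrix.mulVec_mulVec x (A * infty) W] at h2
    obtain ⟨hs0, hs1⟩ := hs
    rcases eq_or_lt_of_le hs0 with rfl | hs0
    · simpa using h0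
    · nlinarith [mul_nonneg (sub_nonneg.2 hs1) (neg_nonneg.2 h0.le), mul_pos hs0 (neg_pos.2 h2),
        mul_nonneg (mul_nonneg hs0.le (sub_nonneg.2 hs1)) h1]

theorem Tame.path_mem_good {d : BoxDiagram n} {r : Fin n → ℝ} (hr : d.Admissible r)
    {A : M4} (hA : Tame r A) {X : External → HC} (hX : X ∈ d.domain r) {s : ℝ}
    (hs : s ∈ Set.Icc (0 : ℝ) 1)
    (h : s = 0 ∨ ((∀ k e, (Vertex.T k, Vertex.ext e) ∈ d.solid → Above (r k) (A * aff (X e))) ∧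
      ∀ k e, (Vertex.ext e, Vertex.T k) ∈ d.solid → Below (r k) (A * aff (X e)))) :
    (fun e => A * path X s e) ∈ d.good r := by
  refine d.mem_good hr (fun k e hke => ?_) (fun k e hke => ?_)
  · have hab := d.above_aff_of_mem_domain hX hke
    have hinj : ∀ x : Fin 2 → ℂ, x ≠ 0 → X e *ᵥ x ≠ 0 := by
      intro x hx h0
      have h1 := hab x hx
      have h2 : nsq (0 : Fin 2 → ℂ) = 0 := by simp [nsq]
      rw [hform_aff, h0, h2] at h1
      nlinarith [mul_nonneg (sq_nonneg (r k)) (nsq_nonneg x)]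
    have key := hA.above_path k hinj hs (h.imp_right fun h => h.1 k e hke)
    rcases d.eq_Z_of_mem_solid hke with rfl | rfl
    · exact key
    · exact key
  · have key := hA.below_path k hs (h.imp_right fun h => h.2 k e hke)
    rcases d.eq_W_of_mem_solid hke with rfl | rfl
    · exact key
    · exact key

/-- Conformal covariance for all `A` such that the segment from the identity to `A` is tame. It
holds near the configuration `Zᵢ = ∞`, `Wᵢ = 0`, uniformly along the segment, and spreads along
`path X` by analyticity. -/
theorem homIntegral_mul_aff {d : BoxDiagram n} {r : Fin n → ℝ} (hr : d.Admissible r) {A : M4}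
    (hdet : ∀ t ∈ Set.Icc (0 : ℝ) 1, (1 + (t : ℂ) • (A - 1)).det ≠ 0)
    (htame : ∀ t ∈ Set.Icc (0 : ℝ) 1, Tame r (1 + (t : ℂ) • (A - 1)))
    {X : External → HC} (hX : X ∈ d.domain r)
    (hAX : ∀ k e, (Vertex.T k, Vertex.ext e) ∈ d.solid → Above (r k) (A * aff (X e)))
    (hBX : ∀ k e, (Vertex.ext e, Vertex.T k) ∈ d.solid → Below (r k) (A * aff (X e))) :
    d.homIntegral r (fun e => A * aff (X e)) =
      (A.det ^ 2)⁻¹ * d.homIntegral r (fun e => aff (X e)) := by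
  have hAt : Tame r A := by simpa using htame 1 (by simp)
  have hcont : Continuous fun p : ℂ × ℝ => fun e => (1 + (p.2 : ℂ) • (A - 1)) * path X p.1 e := by
    have h1 : ∀ e, Continuous fun s => path X s e := fun e =>
      (continuous_apply e).comp (differentiable_path X).continuous
    refine continuous_pi fun e => ?_
    have h2 := h1 e
    fun_prop
  have hnear : ∀ᶠ s : ℂ in 𝓝 0, ∀ t ∈ Set.Icc (0 : ℝ) 1,
      (fun e => (1 + (t : ℂ) • (A - 1)) * path X s e) ∈ d.good r := by
    refine isCompact_Icc.eventually_forall_of_forall_eventually fun t ht => ?_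
    refine hcont.continuousAt.preimage_mem_nhds ((d.isOpen_good r).mem_nhds ?_)
    have := (htame t ht).path_mem_good hr hX (s := 0) (by simp) (Or.inl rfl)
    simpa using this
  let O : Set ℂ := {s | (fun e => A * path X s e) ∈ d.good r} ∩ {s | path X s ∈ d.good r}
  have hpc := (differentiable_path X)
  have hAp : Differentiable ℂ fun s => fun e => A * path X s e := by
    refine differentiable_pi.2 fun e => differentiable_pi.2 fun i => differentiable_pi.2 fun j => ?_
    simp only [Matrix.mul_apply]
    have h1 : ∀ a b, Differentiable ℂ fun s => path X s e a b := fun a b =>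
      differentiable_pi.1 (differentiable_pi.1 (differentiable_pi.1 hpc e) a) b
    fun_prop
  have hO : IsOpen O := ((d.isOpen_good r).preimage hAp.continuous).inter
    ((d.isOpen_good r).preimage hpc.continuous)
  have hseg : Complex.ofReal '' Set.Icc (0 : ℝ) 1 ⊆ O := by
    rintro _ ⟨s, hs, rfl⟩
    refine ⟨hAt.path_mem_good hr hX hs (Or.inr ⟨hAX, hBX⟩), ?_⟩
    have h := (tame_one hr.1).path_mem_good hr hX hs (Or.inr
      ⟨fun k e h => by rw [Matrix.one_mul]; exact d.above_aff_of_mem_domain hX h,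
        fun k e h => by rw [Matrix.one_mul]; exact d.below_aff_of_mem_domain hr hX h⟩)
    simpa using h
  have hd1 : DifferentiableOn ℂ (fun s => d.homIntegral r (fun e => A * path X s e)) O :=
    fun s hs => (DifferentiableAt.comp (f := fun s => fun e => A * path X s e) s
      (d.differentiableAt_homIntegral r hs.1).1 (hAp s)).differentiableWithinAt
  have hd2 : DifferentiableOn ℂ (fun s => (A.det ^ 2)⁻¹ * d.homIntegral r (path X s)) O :=
    fun s hs => ((DifferentiableAt.comp (f := path X) s
      (d.differentiableAt_homIntegral r hs.2).1 (hpc s)).const_mul _).differentiableWithinAt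
  have heq := ((hd1.analyticOnNhd hO).mono hseg).eqOn_of_preconnected_of_eventuallyEq
    ((hd2.analyticOnNhd hO).mono hseg)
    (isPreconnected_Icc.image _ Complex.continuous_ofReal.continuousOn)
    (z₀ := 0) ⟨0, by simp, by simp⟩
    (hnear.mono fun s hs => d.homIntegral_mul r (path X s) A hdet hs)
  have h1 := heq (x := 1) ⟨1, by simp, by simp⟩
  simpa only [path_one] using h1

end BoxDiagram

/-! ### Fractional linear transformations -/

namespace BoxDiagram

open HV

variable {n : ℕ}

/-- The `4 × 4` matrix with the given `2 × 2` blocks. -/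
def flatten (g : Matrix (Fin 2) (Fin 2) HC) : M4 :=
  Matrix.fromBlocks (g 0 0) (g 0 1) (g 1 0) (g 1 1)

theorem flatten_one : flatten 1 = 1 := by
  simp [flatten, Matrix.fromBlocks_one]

theorem continuous_flatten : Continuous flatten := by
  unfold flatten
  fun_prop

/-- In homogeneous coordinates fractional linear transformations are linear maps. -/
theorem flatten_mul_aff (g : GL2HC) (Y : HC) (hY : HC.N (HC.denom g Y) ≠ 0) :
    flatten g.val * aff Y = aff (HC.moebius g Y) * HC.denom g Y := by
  rw [flatten, aff, aff, Matrix.fromBlocks_mul_fromRows, Matrix.fromRows_mul, HC.moebius,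
    Matrix.nonsing_inv_mul_cancel_right _ _ (isUnit_iff_ne_zero.2 hY)]
  simp [HC.denom]

/-- Jacobi's complementary minor identity: it relates the denominators of `h⁻¹` to the entries of
`h`. -/
theorem det_flatten_mul_N (h : GL2HC) (Y : HC) :
    (flatten h⁻¹.val).det * HC.N (h.val 0 0 - Y * h.val 1 0) = HC.N (HC.denom h⁻¹ Y) := by
  have h1 : h⁻¹.val * h.val = 1 := h.inv_mul
  have e00 : h⁻¹.val 0 0 * h.val 0 0 + h⁻¹.val 0 1 * h.val 1 0 = 1 := by
    have := congrFun (congrFun h1 0) 0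
    simpa [Matrix.mul_apply, Fin.sum_univ_two] using this
  have e10 : h⁻¹.val 1 0 * h.val 0 0 + h⁻¹.val 1 1 * h.val 1 0 = 0 := by
    have := congrFun (congrFun h1 1) 0
    simpa [Matrix.mul_apply, Fin.sum_univ_two] using this
  have h2 : flatten h⁻¹.val * (Matrix.fromBlocks 1 Y 0 1 *
      Matrix.fromBlocks (h.val 0 0 - Y * h.val 1 0) 0 (h.val 1 0) 1) =
      Matrix.fromBlocks 1 (h⁻¹.val 0 0 * Y + h⁻¹.val 0 1) 0 (HC.denom h⁻¹ Y) := by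
    rw [flatten, Matrix.fromBlocks_multiply, Matrix.fromBlocks_multiply]
    simp [e00, e10, HC.denom]
  have h3 := congrArg Matrix.det h2
  rw [Matrix.det_mul, Matrix.det_mul, Matrix.det_fromBlocks_zero₂₁, Matrix.det_fromBlocks_zero₁₂,
    Matrix.det_fromBlocks_zero₂₁] at h3
  simpa [HC.N] using h3

theorem l_eq_homIntegral (d : BoxDiagram n) (r : Fin n → ℝ) (X : External → HC) :
    d.l r X = (Complex.I / (2 * (Real.pi : ℂ) ^ 3)) ^ n *
      d.homIntegral r (fun e => aff (X e)) := by
  have h : ∀ T : Fin n → HC, d.integrand X T =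
      d.kernel ((fun e => aff (X e)), fun k => aff (T k)) := by
    intro T
    rw [integrand_eq_edgeProd, kernel]
    congr 1
    funext p q
    rcases p with p | p <;> rcases q with q | q <;> exact (bracket_aff_aff _ _).symm
  rw [l, HC.cycleIntegral, homIntegral]
  simp only [h]
  rfl

theorem homIntegral_mul_right (d : BoxDiagram n) (r : Fin n → ℝ) (u : External → HV)
    (g : External → HC) (hg : ∀ e, (g e).det ≠ 0) :
    d.homIntegral r (fun e => u e * g e) =
      ((g .Z₁).det * (g .Z₂).det * (g .W₁).det * (g .W₂).det)⁻¹ * d.homIntegral r u := by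
  rw [homIntegral, homIntegral, ← MeasureTheory.integral_const_mul]
  congr 1
  funext t
  have h := d.kernel_mul_right (config r u t) g (fun _ => 1) hg (by simp)
  simp only [Matrix.mul_one, Matrix.det_one, one_pow, Finset.prod_const_one, inv_one,
    mul_one] at h
  rw [← mul_assoc, ← h]
  rfl

/-- Matrices near the identity satisfy the hypotheses of `homIntegral_mul_aff`. -/
theorem eventually_tame {r : Fin n → ℝ} (hr : ∀ k, 0 < r k) :
    ∀ᶠ A : M4 in 𝓝 1, ∀ t ∈ Set.Icc (0 : ℝ) 1,
      (1 + (t : ℂ) • (A - 1)).det ≠ 0 ∧ Tame r (1 + (t : ℂ) • (A - 1)) := by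
  have h1 : ∀ᶠ A : M4 in 𝓝 1, A.det ≠ 0 ∧ Tame r A :=
    ((continuous_id.matrix_det.continuousAt (x := (1 : M4))).eventually_ne (by simp)).and
      ((isOpen_tame r).mem_nhds (tame_one hr))
  refine isCompact_Icc.eventually_forall_of_forall_eventually fun t _ => ?_
  have hc : Continuous fun p : M4 × ℝ => 1 + (p.2 : ℂ) • (p.1 - 1) := by fun_prop
  have h2 := hc.tendsto ((1 : M4), t)
  simp only [sub_self, smul_zero, add_zero] at h2
  exact h2.eventually h1

/-- The transformation law of the box integral. -/
theorem l_moebius (d : BoxDiagram n) {r : Fin n → ℝ} (hr : d.Admissible r) {h : GL2HC}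
    (hh : ∀ t ∈ Set.Icc (0 : ℝ) 1, (1 + (t : ℂ) • (flatten h⁻¹.val - 1)).det ≠ 0 ∧
      Tame r (1 + (t : ℂ) • (flatten h⁻¹.val - 1)))
    {X : External → HC} (hX : X ∈ d.domain r) (hD : ∀ e, HC.N (HC.denom h⁻¹ (X e)) ≠ 0)
    (hX' : (fun e => HC.moebius h⁻¹ (X e)) ∈ d.domain r) :
    d.l r (fun e => HC.moebius h⁻¹ (X e)) =
      HC.N (h.val 0 0 - X .Z₁ * h.val 1 0) *
      HC.N (h⁻¹.val 1 0 * X .Z₂ + h⁻¹.val 1 1) *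
      HC.N (h⁻¹.val 1 0 * X .W₁ + h⁻¹.val 1 1) *
      HC.N (h.val 0 0 - X .W₂ * h.val 1 0) * d.l r X := by
  set A := flatten h⁻¹.val with hA
  have hmul : ∀ e, A * aff (X e) = aff (HC.moebius h⁻¹ (X e)) * HC.denom h⁻¹ (X e) := fun e =>
    flatten_mul_aff _ _ (hD e)
  have hcov := homIntegral_mul_aff hr (fun t ht => (hh t ht).1) (fun t ht => (hh t ht).2) hX
    (fun k e hke => by
      rw [hmul]
      exact (d.above_aff_of_mem_domain hX' hke).mul_right (hD e))
    (fun k e hke => by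
      rw [hmul]
      exact (d.below_aff_of_mem_domain hr hX' hke).mul_right (hD e))
  simp only [hmul] at hcov
  rw [d.homIntegral_mul_right r _ _ hD] at hcov
  have hdet : A.det ≠ 0 := by
    have := (hh 1 (by simp)).1
    simpa using this
  have hZ := det_flatten_mul_N h (X .Z₁)
  have hW := det_flatten_mul_N h (X .W₂)
  rw [← hA] at hZ hW
  rw [l_eq_homIntegral, l_eq_homIntegral, (inv_mul_eq_iff_eq_mul₀ (by
    exact mul_ne_zero (mul_ne_zero (mul_ne_zero (hD _) (hD _)) (hD _)) (hD _))).1 hcov]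
  change _ * (HC.N (HC.denom h⁻¹ (X .Z₁)) * HC.N (HC.denom h⁻¹ (X .Z₂)) *
    HC.N (HC.denom h⁻¹ (X .W₁)) * HC.N (HC.denom h⁻¹ (X .W₂)) * _) =
    _ * HC.N (HC.denom h⁻¹ (X .Z₂)) * HC.N (HC.denom h⁻¹ (X .W₁)) * _ * _
  rw [← hZ, ← hW]
  field_simp

theorem isOpen_DMinus (R : ℝ) : IsOpen (HC.DMinus R) := by
  have h : HC.DMinus R = (fun Z : HC => aff Zᴴ) ⁻¹' {u | Above R u} := by
    ext Z
    exact mem_DMinus_iff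
  rw [h]
  exact (isOpen_above R).preimage (contDiff_aff.continuous.comp continuous_id.matrix_conjTranspose)

theorem isOpen_DPlus (R : ℝ) : IsOpen (HC.DPlus R) := by
  have h : HC.DPlus R = (fun Z : HC => aff Zᴴ) ⁻¹' {u | Below R u} := by
    ext Z
    exact mem_DPlus_iff
  rw [h]
  exact (isOpen_below R).preimage (contDiff_aff.continuous.comp continuous_id.matrix_conjTranspose)

theorem isOpen_domain (d : BoxDiagram n) (r : Fin n → ℝ) : IsOpen (d.domain r) := by
  have hi : ∀ (p : Prop) (e : External) {S : Set HC}, IsOpen S →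
      IsOpen {X : External → HC | p → X e ∈ S} := by
    intro p e S hS
    by_cases hp : p
    · simp only [hp, true_imp_iff]
      exact hS.preimage (continuous_apply e)
    · simp [hp]
  have h : d.domain r = ⋂ k,
      {X | d.Prec (.T k) (.ext .Z₁) → X .Z₁ ∈ HC.DMinus (r k)} ∩
      ({X | d.Prec (.T k) (.ext .Z₂) → X .Z₂ ∈ HC.DMinus (r k)} ∩
      ({X | d.Prec (.ext .W₁) (.T k) → X .W₁ ∈ HC.DPlus (r k)} ∩
      {X | d.Prec (.ext .W₂) (.T k) → X .W₂ ∈ HC.DPlus (r k)})) := by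
    ext X
    simp [domain]
  rw [h]
  exact isOpen_iInter_of_finite fun k => (hi _ _ (isOpen_DMinus _)).inter
    ((hi _ _ (isOpen_DMinus _)).inter ((hi _ _ (isOpen_DPlus _)).inter (hi _ _ (isOpen_DPlus _))))

theorem continuous_denom : Continuous fun p : GL2HC × HC => HC.denom p.1⁻¹ p.2 := by
  have h : Continuous fun p : GL2HC × HC => (p.1⁻¹).val :=
    Units.continuous_val.comp (continuous_inv.comp continuous_fst)
  unfold HC.denom
  fun_prop

theorem continuousAt_moebius (Y : HC) :
    ContinuousAt (fun p : GL2HC × HC => HC.moebius p.1⁻¹ p.2) (1, Y) := by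
  have h : Continuous fun p : GL2HC × HC => (p.1⁻¹).val :=
    Units.continuous_val.comp (continuous_inv.comp continuous_fst)
  have h1 : Continuous fun p : GL2HC × HC => p.1⁻¹.val 0 0 * p.2 + p.1⁻¹.val 0 1 := by fun_prop
  unfold HC.moebius
  refine h1.continuousAt.mul ?_
  have h2 : ContinuousAt (fun p : GL2HC × HC => (HC.denom p.1⁻¹ p.2).det) (1, Y) :=
    continuous_denom.matrix_det.continuousAt
  have h3 := (h2.inv₀ (by simp [HC.denom])).smul continuous_denom.matrix_adjugate.continuousAt
  simp only [Matrix.inv_def, Ring.inverse_eq_inv']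
  exact h3

theorem eventually_moebius_mem (d : BoxDiagram n) (r : Fin n → ℝ) {K : Set (External → HC)}
    (hK : K ⊆ d.domain r) (hKc : IsCompact K) : ∀ᶠ h : GL2HC in 𝓝 1, ∀ X ∈ K,
      (∀ e, HC.N (HC.denom h⁻¹ (X e)) ≠ 0) ∧ (fun e => HC.moebius h⁻¹ (X e)) ∈ d.domain r := by
  refine hKc.eventually_forall_of_forall_eventually fun X hX => ?_
  have he : ∀ e, Continuous fun p : GL2HC × (External → HC) => (p.1, p.2 e) := fun e => by fun_prop
  refine Filter.Eventually.and ?_ ?_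
  · refine Filter.eventually_all.2 fun e => ?_
    have hc := (continuous_denom.comp (he e)).matrix_det.continuousAt (x := (1, X))
    exact hc.eventually_ne (by simp [HC.denom])
  · have hc : ContinuousAt (fun p : GL2HC × (External → HC) =>
        fun e => HC.moebius p.1⁻¹ (p.2 e)) (1, X) := by
      refine continuousAt_pi.2 fun e => ?_
      exact ContinuousAt.comp (f := fun p : GL2HC × (External → HC) => (p.1, p.2 e))
        (g := fun p : GL2HC × HC => HC.moebius p.1⁻¹ p.2) (continuousAt_moebius (X e))
        (he e).continuousAt
    refine hc.preimage_mem_nhds ((d.isOpen_domain r).mem_nhds ?_)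
    have h1 : (fun e => HC.moebius (1 : GL2HC)⁻¹ (X e)) = X := by
      funext e
      simp [HC.moebius, HC.denom]
    change (fun e => HC.moebius (1 : GL2HC)⁻¹ (X e)) ∈ _
    rw [h1]
    exact hK hX

end BoxDiagram

end

theorem mainTheorem4 {n : ℕ} (D : BoxDiagram n) (r : Fin n → ℝ) (hr : D.Admissible r) :
    (∀ᶠ h : GL2HC in 𝓝 1, ∀ X ∈ D.domain r,
      (∀ e, HC.N (HC.denom h⁻¹ (X e)) ≠ 0) →
      (fun e => HC.moebius h⁻¹ (X e)) ∈ D.domain r →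
      D.l r (fun e => HC.moebius h⁻¹ (X e)) =
        HC.N (h.val 0 0 - X .Z₁ * h.val 1 0) *
        HC.N (h⁻¹.val 1 0 * X .Z₂ + h⁻¹.val 1 1) *
        HC.N (h⁻¹.val 1 0 * X .W₁ + h⁻¹.val 1 1) *
        HC.N (h.val 0 0 - X .W₂ * h.val 1 0) * D.l r X) ∧
    (∀ K ⊆ D.domain r, IsCompact K → ∀ᶠ h : GL2HC in 𝓝 1, ∀ X ∈ K,
      (∀ e, HC.N (HC.denom h⁻¹ (X e)) ≠ 0) ∧
      (fun e => HC.moebius h⁻¹ (X e)) ∈ D.domain r) := by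
  refine ⟨?_, fun K hK hKc => D.eventually_moebius_mem r hK hKc⟩
  have hc : Continuous fun h : GL2HC => BoxDiagram.flatten h⁻¹.val :=
    BoxDiagram.continuous_flatten.comp (Units.continuous_val.comp continuous_inv)
  have h1 := hc.tendsto 1
  simp only [inv_one, Units.val_one, BoxDiagram.flatten_one] at h1
  filter_upwards [h1.eventually (BoxDiagram.eventually_tame hr.1)] with h hh X hX hD hX'
  exact D.l_moebius hr hh hX hD hX'
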